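/- Let $a,b,c>0$. Let $D_1$, $D_2$ be the $7_1$ pair of Buser, Conway, Doyle and Semmler: each $D_i$ is tiled by seven copies $T_0,\dots,T_6$ of a triangle with sides labelled $a,b,c$, adjacent copies being mirror images of each other in their common side. In $D_1$ the pairs of adjacent copies are $T_0T_5,\ T_3T_4$ (along side $a$), $T_0T_3,\ T_1T_2$ (along side $b$), $T_0T_1,\ T_5T_6$ (along side $c$); $D_2$ is obtained by interchanging the labels $b$ and $c$ in this list. The quantum graph analog $G_i$ of $D_i$ is the metric graph in which every copy of the triangle is replaced by a 3-star, consisting of a central vertex and three edges of lengths $a,b,c$, and in which two edges of different stars are joined at their outer ends (in a vertex of degree 2) whenever the corresponding sides of the triangles coincide. The operator $\Delta=d^2/dx^2$ on $L^2(G_i)$ carries Dirichlet standard boundary conditions: its domain consists of the continuous functions on $G_i$ that, on every edge, have absolutely continuous first derivative and square integrable second derivative, that vanish at the vertices of degree $1$, and for which at every other vertex the sum of the derivatives along the edges, directed into the vertex, is $0$. Then: 1. $G_1$ and $G_2$ are isospectral: $-\Delta$ has the same spectrum, with the same multiplicities of eigenvalues, on $G_1$ and $G_2$. 2. If $a,b,c$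 are distinct, then $G_1$ and $G_2$, with their path metrics, are not isometric. 3. The problem $\Delta u_i=-1$ with Dirichlet standard boundary conditions has exactly one solution $u_i$ on $G_i$ ($i=1,2$), and the torsional rigidities $\int_{G_i}u_i$ satisfy $$\int_{G_1}u_1-\int_{G_2}u_2=(a-b)(a-c)(b-c)\,\frac{N(a,b,c)}{D(a,b,c)},$$ where $$N=-4\,(bc+a(b+c))\bigl(11a^3(b+c)+bc(11b^2+23bc+11c^2)+a(b+c)(11b^2+48bc+11c^2)+a^2(23b^2+59bc+23c^2)\bigr)<0,$$ $$D=32a^4(b+c)^2+8b^2c^2(4b^2+9bc+4c^2)+8abc(b+c)(8b^2+23bc+8c^2)+8a^3(b+c)(9b^2+22bc+9c^2)+a^2(32b^4+248b^3c+439b^2c^2+248bc^3+32c^4)>0.$$ In particular, the torsional rigidities of $G_1$ and $G_2$ differ whenever $a,b,c$ are distinct. -/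

import Mathlib

open MeasureTheory
open scoped ENNReal NNReal

/-- A compact metric graph with vertex set `V` and edge set `E`: every edge `e` is oriented from
`src e` to `tgt e` and identified with the interval `[0, len e]`. The graph is connected and has
no loops. -/
structure MetricGraph (V E : Type) where
  src : E → V
  tgt : E → V
  len : E → ℝ
  len_pos : ∀ e, 0 < len e
  no_loop : ∀ e, src e ≠ tgt e
  connected : (SimpleGraph.fromRel fun u v => ∃ e, src e = u ∧ tgt e = v).Connected

namespace MetricGraph

section Points

variable {V E : Type}

/-- The points of a metric graph: its vertices and the interior points of its edges. -/
inductive Point (G : MetricGraph V E) : Type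
  | vertex (v : V) : Point G
  | inner (e : E) (x : ℝ) (hx : x ∈ Set.Ioo 0 (G.len e)) : Point G

open Classical in
/-- The point of the edge `e` with coordinate `x ∈ [0, len e]` (coordinates outside this interval
are projected to the nearest end). -/
noncomputable def pointOn (G : MetricGraph V E) (e : E) (x : ℝ) : G.Point :=
  if h : x ∈ Set.Ioo 0 (G.len e) then .inner e x h
  else if x ≤ 0 then .vertex (G.src e) else .vertex (G.tgt e)

/-- `G.Route p q L`: there is a path from `p` to `q` that consists of finitely many segments, each
contained in one closed edge, and has total length `L`. -/
inductive Route (G : MetricGraph V E) : G.Point → G.Point → ℝ≥0 → Prop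
  | nil (p : G.Point) : Route G p p 0
  | cons (e : E) (s t : ℝ) (hs : s ∈ Set.Icc 0 (G.len e)) (ht : t ∈ Set.Icc 0 (G.len e))
      {q : G.Point} {L : ℝ≥0} (h : Route G (G.pointOn e t) q L) :
      Route G (G.pointOn e s) q (nndist s t + L)

theorem Route.trans {G : MetricGraph V E} {p q r : G.Point} {L M : ℝ≥0}
    (h : G.Route p q L) (h' : G.Route q r M) : G.Route p r (L + M) := by
  induction h with
  | nil p => simpa using h'
  | cons e s t hs ht _ ih =>
    rw [add_assoc]
    exact .cons e s t hs ht (ih h')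

theorem Route.symm {G : MetricGraph V E} {p q : G.Point} {L : ℝ≥0}
    (h : G.Route p q L) : G.Route q p L := by
  induction h with
  | nil p => exact .nil p
  | cons e s t hs ht _ ih =>
    have h1 := ih.trans (Route.cons e t s ht hs (.nil _))
    rwa [add_zero, nndist_comm, add_comm] at h1

/-- The path metric of a metric graph: the infimum of the lengths of the paths that join two
points. -/
noncomputable instance (G : MetricGraph V E) : PseudoEMetricSpace G.Point where
  edist p q := ⨅ (L : ℝ≥0) (_ : G.Route p q L), (L : ℝ≥0∞)
  edist_self p := le_antisymm (iInf₂_le_of_le 0 (.nil p) (by simp)) (by simp)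
  edist_comm p q := le_antisymm
    (le_iInf₂ fun L h => iInf₂_le L h.symm) (le_iInf₂ fun L h => iInf₂_le L h.symm)
  edist_triangle p q r := by
    refine ENNReal.le_iInf₂_add_iInf₂ fun L h M k => ?_
    exact iInf₂_le_of_le (L + M) (h.trans k) (by simp)

end Points

/-- `f` belongs to the second order Sobolev space of `[0, l]`, with first derivative `g` and second
derivative `h`: `f` and `g = f'` are absolutely continuous on `[0, l]` and `h = f''` is square
integrable. -/
structure EdgeH2 {𝕜 : Type} [RCLike 𝕜] (l : ℝ) (f g h : ℝ → 𝕜) : Prop where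
  memLp : MemLp h 2 (volume.restrict (Set.Icc 0 l))
  deriv_eq : ∀ x ∈ Set.Icc 0 l, g x = g 0 + ∫ t in (0 : ℝ)..x, h t
  eq : ∀ x ∈ Set.Icc 0 l, f x = f 0 + ∫ t in (0 : ℝ)..x, g t

section Laplacian

variable {V E : Type} [Fintype E] [DecidableEq V]

/-- The number of edges at the vertex `v`. -/
def degree (G : MetricGraph V E) (v : V) : ℕ :=
  (Finset.univ.filter fun e => G.src e = v ∨ G.tgt e = v).card

/-- The function `φ` on `G` satisfies Dirichlet standard boundary conditions, where `dφ` and `ddφ`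
are its first and second derivatives along the edges: it is in `H²` of every edge, continuous (all
edges at a vertex `v` share the value `φ (.vertex v)`), zero at the vertices of degree one, and at
every other vertex the derivatives directed into the vertex add up to zero. -/
structure IsDSBC {𝕜 : Type} [RCLike 𝕜] (G : MetricGraph V E) (φ : G.Point → 𝕜)
    (dφ ddφ : E → ℝ → 𝕜) : Prop where
  edge : ∀ e, EdgeH2 (G.len e) (fun x => φ (G.pointOn e x)) (dφ e) (ddφ e)
  dirichlet : ∀ v, G.degree v = 1 → φ (.vertex v) = 0
  kirchhoff : ∀ v, G.degree v ≠ 1 →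
    ∑ e with G.tgt e = v, dφ e (G.len e) + ∑ e with G.src e = v, -dφ e 0 = 0

/-- `φ` is in the domain of the Laplacian `Δ` of `G` with Dirichlet standard boundary conditions
and `-Δ φ - z φ = f` in `L²(G)`. -/
def Solves {𝕜 : Type} [RCLike 𝕜] (G : MetricGraph V E) (z : 𝕜) (f : E → ℝ → 𝕜)
    (φ : G.Point → 𝕜) : Prop :=
  ∃ dφ ddφ : E → ℝ → 𝕜, G.IsDSBC φ dφ ddφ ∧
    ∀ e, ∀ᵐ x ∂(volume.restrict (Set.Icc 0 (G.len e))),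
      -ddφ e x - z * φ (G.pointOn e x) = f e x

theorem EdgeH2.intervalIntegrable {𝕜 : Type} [RCLike 𝕜] {l : ℝ} {f g h : ℝ → 𝕜}
    (H : EdgeH2 l f g h) {x : ℝ} (hx : x ∈ Set.Icc 0 l) :
    IntervalIntegrable h volume 0 x ∧ IntervalIntegrable g volume 0 x := by
  have hi : IntegrableOn h (Set.Icc 0 l) := H.memLp.integrable (by norm_num)
  have hu : Set.uIcc 0 l = Set.Icc 0 l := Set.uIcc_of_le (hx.1.trans hx.2)
  have hc : ContinuousOn g (Set.Icc 0 l) := by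
    rw [← hu] at hi ⊢
    exact (continuousOn_const.add
      (intervalIntegral.continuousOn_primitive_interval hi)).congr (hu ▸ H.deriv_eq)
  have hs : Set.uIcc 0 x ⊆ Set.Icc 0 l := by
    rw [Set.uIcc_of_le hx.1]; exact Set.Icc_subset_Icc_right hx.2
  exact ⟨(hi.mono_set hs).intervalIntegrable, (hc.mono hs).intervalIntegrable⟩

theorem EdgeH2.add {𝕜 : Type} [RCLike 𝕜] {l : ℝ} {f g h f' g' h' : ℝ → 𝕜}
    (H : EdgeH2 l f g h) (H' : EdgeH2 l f' g' h') :
    EdgeH2 l (fun x => f x + f' x) (fun x => g x + g' x) (fun x => h x + h' x) where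
  memLp := H.memLp.add H'.memLp
  deriv_eq x hx := by
    rw [intervalIntegral.integral_add (H.intervalIntegrable hx).1 (H'.intervalIntegrable hx).1,
      H.deriv_eq x hx, H'.deriv_eq x hx]
    ring
  eq x hx := by
    rw [intervalIntegral.integral_add (H.intervalIntegrable hx).2 (H'.intervalIntegrable hx).2]
    simp only [H.eq x hx, H'.eq x hx]
    ring

theorem EdgeH2.const_mul {𝕜 : Type} [RCLike 𝕜] {l : ℝ} {f g h : ℝ → 𝕜}
    (H : EdgeH2 l f g h) (c : 𝕜) :
    EdgeH2 l (fun x => c * f x) (fun x => c * g x) (fun x => c * h x) where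
  memLp := H.memLp.const_mul c
  deriv_eq x hx := by rw [intervalIntegral.integral_const_mul, H.deriv_eq x hx]; ring
  eq x hx := by
    rw [intervalIntegral.integral_const_mul]
    simp only [H.eq x hx]
    ring

/-- The eigenspace of `-Δ` for `z`. -/
def eigenspace (G : MetricGraph V E) (z : ℂ) : Submodule ℂ (G.Point → ℂ) where
  carrier := {φ | G.Solves z 0 φ}
  zero_mem' := ⟨0, 0, ⟨fun _ => ⟨MemLp.zero', by simp, by simp⟩, by simp, by simp⟩, by simp⟩
  add_mem' := by
    rintro φ ψ ⟨dφ, ddφ, h, hz⟩ ⟨dψ, ddψ, k, kz⟩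
    refine ⟨fun e x => dφ e x + dψ e x, fun e x => ddφ e x + ddψ e x,
      ⟨fun e => (h.edge e).add (k.edge e), fun v hv => ?_, fun v hv => ?_⟩, fun e => ?_⟩
    · simp [h.dirichlet v hv, k.dirichlet v hv]
    · have h1 := h.kirchhoff v hv
      have h2 := k.kirchhoff v hv
      simp only [Finset.sum_neg_distrib, Finset.sum_add_distrib] at *
      linear_combination h1 + h2
    · filter_upwards [hz e, kz e] with x hx kx
      simp only [Pi.add_apply, Pi.zero_apply] at *
      linear_combination hx + kx
  smul_mem' := by
    rintro c φ ⟨dφ, ddφ, h, hz⟩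
    refine ⟨fun e x => c * dφ e x, fun e x => c * ddφ e x,
      ⟨fun e => (h.edge e).const_mul c, fun v hv => ?_, fun v hv => ?_⟩, fun e => ?_⟩
    · simp [h.dirichlet v hv]
    · have h1 := h.kirchhoff v hv
      simp only [Finset.sum_neg_distrib, ← Finset.mul_sum] at *
      linear_combination c * h1
    · filter_upwards [hz e] with x hx
      simp only [Pi.smul_apply, smul_eq_mul, Pi.zero_apply] at *
      linear_combination c * hx

/-- The spectrum of `-Δ`: the complex numbers `z` for which `-Δ - z` is not a bijection from the
domain of `Δ` onto `L²(G)`. -/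
def spec (G : MetricGraph V E) : Set ℂ :=
  {z | ¬ ∀ f : E → ℝ → ℂ, (∀ e, MemLp (f e) 2 (volume.restrict (Set.Icc 0 (G.len e)))) →
    ∃! φ : G.Point → ℂ, G.Solves z f φ}

/-- Two quantum graphs are isospectral if they have the same spectrum and the same multiplicities
of eigenvalues. -/
def Isospectral {V' E' : Type} [Fintype E'] [DecidableEq V']
    (G : MetricGraph V E) (G' : MetricGraph V' E') : Prop :=
  G.spec = G'.spec ∧
    ∀ z : ℂ, Module.rank ℂ (G.eigenspace z) = Module.rank ℂ (G'.eigenspace z)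

/-- `u` solves `Δ u = -1` on `G` with Dirichlet standard boundary conditions. -/
def IsTorsionFunction (G : MetricGraph V E) (u : G.Point → ℝ) : Prop :=
  G.Solves 0 (fun _ _ => 1) u

/-- The integral of a function over `G`. -/
noncomputable def integral (G : MetricGraph V E) (u : G.Point → ℝ) : ℝ :=
  ∑ e, ∫ x in (0 : ℝ)..G.len e, u (G.pointOn e x)

end Laplacian

end MetricGraph

/-- The combinatorial scheme of a domain that is tiled by `n` copies of a triangle with labelled
sides: `refl x i` is the copy that is the mirror image of the copy `i` in its side `x`, if this
side is interior to the domain, and is `i` itself if this side is on the boundary. -/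
structure Tiling (n : ℕ) where
  refl : Fin 3 → Equiv.Perm (Fin n)
  invol : ∀ x i, refl x (refl x i) = i
  connected : (SimpleGraph.fromRel fun i j => ∃ x, refl x i = j).Connected

namespace Tiling

variable {n : ℕ} (T : Tiling n)

/-- The vertices of the quantum graph analog: the center of the 3-star of every copy `i`, and one
vertex for every side in the tiling. A side `x` common to two copies is represented by the smaller
index of the two. -/
abbrev StarVertex : Type := Fin n ⊕ {p : Fin n × Fin 3 // p.1 ≤ T.refl p.2 p.1}

/-- The outer vertex on the side `x` of the copy `i`. -/
def outer (i : Fin n) (x : Fin 3) : {p : Fin n × Fin 3 // p.1 ≤ T.refl p.2 p.1} :=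
  ⟨(min i (T.refl x i), x), by
    rcases le_total i (T.refl x i) with h | h
    · simp [h]
    · simp [h, T.invol]⟩

theorem outer_refl (i : Fin n) (x : Fin 3) : T.outer (T.refl x i) x = T.outer i x := by
  simp [outer, T.invol, min_comm]

/-- The quantum graph analog of a tiled domain: every copy of the triangle is replaced by a 3-star
whose edges carry the labels of the sides of the triangle, an edge labelled `x` having length
`ℓ x`; two edges of the stars are joined at their outer ends if the corresponding sides of the
triangles coincide. -/
def starGraph (ℓ : Fin 3 → ℝ) (hℓ : ∀ x, 0 < ℓ x) :
    MetricGraph T.StarVertex (Fin n × Fin 3) where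
  src e := .inl e.1
  tgt e := .inr (T.outer e.1 e.2)
  len e := ℓ e.2
  len_pos e := hℓ e.2
  no_loop e := by simp
  connected := by
    set Γ := SimpleGraph.fromRel fun u v : T.StarVertex =>
      ∃ e : Fin n × Fin 3, Sum.inl e.1 = u ∧ Sum.inr (T.outer e.1 e.2) = v
    have h1 : ∀ i x, Γ.Reachable (.inl i) (.inr (T.outer i x)) := fun i x =>
      SimpleGraph.Adj.reachable ⟨by simp, .inl ⟨(i, x), rfl, rfl⟩⟩
    have h2 : ∀ i x, Γ.Reachable (.inl i) (.inl (T.refl x i)) := fun i x => by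
      have h := h1 (T.refl x i) x
      rw [outer_refl] at h
      exact (h1 i x).trans h.symm
    have h3 : ∀ i j, Γ.Reachable (.inl i) (.inl j) := fun i j => by
      obtain ⟨w⟩ := T.connected.preconnected i j
      induction w with
      | nil => exact .refl _
      | cons h _ ih =>
        refine SimpleGraph.Reachable.trans ?_ ih
        obtain ⟨-, ⟨x, rfl⟩ | ⟨x, rfl⟩⟩ := h
        · exact h2 _ x
        · exact (h2 _ x).symm
    have h4 : ∀ v : T.StarVertex, ∃ i, Γ.Reachable v (.inl i) := by
      rintro (i | ⟨⟨i, x⟩, h⟩)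
      · exact ⟨i, .refl _⟩
      · refine ⟨i, ?_⟩
        have h5 := h1 i x
        simp only [outer, min_eq_left h] at h5
        exact h5.symm
    obtain ⟨i₀⟩ := T.connected.nonempty
    refine @SimpleGraph.Connected.mk _ _ (fun u v => ?_) ⟨.inl i₀⟩
    obtain ⟨i, hi⟩ := h4 u
    obtain ⟨j, hj⟩ := h4 v
    exact (hi.trans (h3 i j)).trans hj.symm

end Tiling

/-- If every copy is reached from the copy `0` in at most two reflections, the tiling is
connected. -/
theorem connected_of_reach (r : Fin 3 → Equiv.Perm (Fin 7))
    (h : ∀ i, ∃ x y, r y (r x 0) = i) :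
    (SimpleGraph.fromRel fun i j => ∃ x, r x i = j).Connected := by
  set Γ := SimpleGraph.fromRel fun i j => ∃ x, r x i = j
  have h1 : ∀ x i, Γ.Reachable i (r x i) := fun x i => by
    by_cases e : i = r x i
    · rw [← e]
    · exact SimpleGraph.Adj.reachable ⟨e, .inl ⟨x, rfl⟩⟩
  have h2 : ∀ i, Γ.Reachable 0 i := fun i => by
    obtain ⟨x, y, rfl⟩ := h i
    exact (h1 x 0).trans (h1 y _)
  exact @SimpleGraph.Connected.mk _ _ (fun i j => (h2 i).symm.trans (h2 j)) ⟨0⟩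

/-- First domain of the pair `7₁`; the labels `0, 1, 2` stand for the sides `a, b, c`. The copies
are glued as follows: `0` and `5`, `3` and `4` along `a`; `0` and `3`, `1` and `2` along `b`;
`0` and `1`, `5` and `6` along `c`. -/
def pair71₁ : Tiling 7 where
  refl := ![Equiv.swap 0 5 * Equiv.swap 3 4, Equiv.swap 0 3 * Equiv.swap 1 2,
    Equiv.swap 0 1 * Equiv.swap 5 6]
  invol := by decide
  connected := connected_of_reach _ (by decide)

/-- Second domain of the pair `7₁`: the gluing of the first one with `b` and `c` interchanged. -/
def pair71₂ : Tiling 7 where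
  refl := ![Equiv.swap 0 5 * Equiv.swap 3 4, Equiv.swap 0 1 * Equiv.swap 5 6,
    Equiv.swap 0 3 * Equiv.swap 1 2]
  invol := by decide
  connected := connected_of_reach _ (by decide)

theorem lengths_pos {a b c : ℝ} (ha : 0 < a) (hb : 0 < b) (hc : 0 < c) :
    ∀ x, 0 < (![a, b, c] : Fin 3 → ℝ) x := by
  intro x
  fin_cases x <;> simpa

/-- The first quantum graph, with edges of lengths `a`, `b`, `c`. -/
def graph71₁ {a b c : ℝ} (ha : 0 < a) (hb : 0 < b) (hc : 0 < c) :
    MetricGraph pair71₁.StarVertex (Fin 7 × Fin 3) :=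
  pair71₁.starGraph ![a, b, c] (lengths_pos ha hb hc)

/-- The second quantum graph, with edges of lengths `a`, `b`, `c`. -/
def graph71₂ {a b c : ℝ} (ha : 0 < a) (hb : 0 < b) (hc : 0 < c) :
    MetricGraph pair71₂.StarVertex (Fin 7 × Fin 3) :=
  pair71₂.starGraph ![a, b, c] (lengths_pos ha hb hc)

/-- Numerator of the factor `R`. -/
def torsionN (a b c : ℝ) : ℝ :=
  -4 * (b * c + a * (b + c)) *
    (11 * a ^ 3 * (b + c) + b * c * (11 * b ^ 2 + 23 * b * c + 11 * c ^ 2) +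
      a * (b + c) * (11 * b ^ 2 + 48 * b * c + 11 * c ^ 2) +
      a ^ 2 * (23 * b ^ 2 + 59 * b * c + 23 * c ^ 2))

/-- Denominator of the factor `R`. -/
def torsionD (a b c : ℝ) : ℝ :=
  32 * a ^ 4 * (b + c) ^ 2 + 8 * b ^ 2 * c ^ 2 * (4 * b ^ 2 + 9 * b * c + 4 * c ^ 2) +
    8 * a * b * c * (b + c) * (8 * b ^ 2 + 23 * b * c + 8 * c ^ 2) +
    8 * a ^ 3 * (b + c) * (9 * b ^ 2 + 22 * b * c + 9 * c ^ 2) +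
    a ^ 2 * (32 * b ^ 4 + 248 * b ^ 3 * c + 439 * b ^ 2 * c ^ 2 + 248 * b * c ^ 3 + 32 * c ^ 4)

/-! Isospectrality is transplantation. Encode gluing along a label `x` by the signed permutation
matrix `P x` of the tiles that exchanges the two tiles at an interior side and is `-1` on a tile
whose side is on the boundary. At the outer ends of the `x`-edges, continuity and the Dirichlet
condition say that the vector of values is fixed by `P x`; the Kirchhoff condition says that the
vector of derivatives is negated by `P x`. A matrix `A` with `A * P x = P' x * A` for every `x`
therefore carries these conditions from one graph to the other. The center conditions and the
equation are linear and the same on every star, so they survive linear combinations of tiles. An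
explicit invertible `A` then identifies eigenspaces and resolvents (`Tiling.isospectral`).

For torsion, a solution is a quadratic on every edge, and its slopes are determined by the values at
the centers (`Tiling.isTorsionFunction_iff`). What remains is one linear equation per center. An
energy identity gives uniqueness, and an explicit rational solution gives existence. The first
gluing tree consists of three branches of two tiles at the tile `0`, permuted by a rotation of the
tree combined with a cyclic permutation of the labels. Hence one branch gives all the values, and
the second graph is the first one with `b` and `c` interchanged. The difference of rigidities
becomes a polynomial identity.

For non-isometry, the centers are exactly the metric branch points, so an isometry permutes them and
preserves their distances. The sums of the cubes of these distances differ by a nonzero multiple of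
`(a - b) * (a - c) * (b - c)`. -/

namespace MetricGraph

variable {V E : Type}

theorem pointOn_of_nonpos (G : MetricGraph V E) (e : E) {x : ℝ} (hx : x ≤ 0) :
    G.pointOn e x = .vertex (G.src e) := by
  unfold pointOn
  rw [dif_neg (fun h => absurd h.1 hx.not_gt), if_pos hx]

theorem pointOn_of_len_le (G : MetricGraph V E) (e : E) {x : ℝ} (hx : G.len e ≤ x) :
    G.pointOn e x = .vertex (G.tgt e) := by
  unfold pointOn
  rw [dif_neg (fun h => absurd h.2 hx.not_gt), if_neg ((G.len_pos e).trans_le hx).not_ge]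

theorem pointOn_of_mem (G : MetricGraph V E) (e : E) {x : ℝ} (hx : x ∈ Set.Ioo 0 (G.len e)) :
    G.pointOn e x = .inner e x hx := by
  unfold pointOn
  rw [dif_pos hx]

end MetricGraph

theorem MetricGraph.EdgeH2.zero {𝕜 : Type} [RCLike 𝕜] (l : ℝ) :
    MetricGraph.EdgeH2 l (fun _ => (0 : 𝕜)) (fun _ => 0) (fun _ => 0) :=
  ⟨MemLp.zero', by simp, by simp⟩

theorem MetricGraph.EdgeH2.sum {𝕜 ι : Type} [RCLike 𝕜] {l : ℝ} {f g h : ι → ℝ → 𝕜} (s : Finset ι)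
    (c : ι → 𝕜) (H : ∀ i, MetricGraph.EdgeH2 l (f i) (g i) (h i)) :
    MetricGraph.EdgeH2 l (fun x => ∑ i ∈ s, c i * f i x) (fun x => ∑ i ∈ s, c i * g i x)
      (fun x => ∑ i ∈ s, c i * h i x) := by
  classical
  induction s using Finset.induction_on with
  | empty => simpa using EdgeH2.zero l
  | insert i s hi ih =>
    simp only [Finset.sum_insert hi]
    exact ((H i).const_mul (c i)).add ih

/-! ### Star graphs and their boundary conditions -/

namespace Tiling

variable {n : ℕ} (T : Tiling n) (ℓ : Fin 3 → ℝ) (hℓ : ∀ x, 0 < ℓ x)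

theorem outer_eq_outer {i j : Fin n} {x y : Fin 3} :
    T.outer j y = T.outer i x ↔ y = x ∧ (j = i ∨ j = T.refl x i) := by
  constructor
  · intro h
    have h' := congrArg Subtype.val h
    simp only [outer, Prod.mk.injEq] at h'
    obtain ⟨h1, rfl⟩ := h'
    refine ⟨rfl, ?_⟩
    have hj : ∀ k, min k (T.refl y k) = k ∨ min k (T.refl y k) = T.refl y k := fun k =>
      (min_choice _ _)
    rcases hj j with h2 | h2 <;> rcases hj i with h3 | h3 <;> rw [h2, h3] at h1
    · exact .inl h1
    · exact .inr h1
    · right; rw [← h1, T.invol]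
    · left; exact (T.refl y).injective h1
  · rintro ⟨rfl, rfl | rfl⟩
    · rfl
    · exact T.outer_refl _ _

theorem exists_outer (p : {p : Fin n × Fin 3 // p.1 ≤ T.refl p.2 p.1}) :
    p = T.outer p.1.1 p.1.2 := by
  obtain ⟨⟨i, x⟩, h⟩ := p
  simp [outer, min_eq_left h]

@[simp] theorem starGraph_len (e : Fin n × Fin 3) : (T.starGraph ℓ hℓ).len e = ℓ e.2 := rfl

@[simp] theorem starGraph_src (e : Fin n × Fin 3) : (T.starGraph ℓ hℓ).src e = .inl e.1 := rfl

@[simp] theorem starGraph_tgt (e : Fin n × Fin 3) :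
    (T.starGraph ℓ hℓ).tgt e = .inr (T.outer e.1 e.2) := rfl

theorem degree_center (i : Fin n) : (T.starGraph ℓ hℓ).degree (.inl i) = 3 := by
  have : (Finset.univ.filter fun e : Fin n × Fin 3 =>
      (T.starGraph ℓ hℓ).src e = .inl i ∨ (T.starGraph ℓ hℓ).tgt e = .inl i) =
      {i} ×ˢ Finset.univ := by
    ext ⟨j, y⟩; simp [eq_comm]
  rw [MetricGraph.degree, this]
  simp

theorem filter_outer (i : Fin n) (x : Fin 3) :
    (Finset.univ.filter fun e : Fin n × Fin 3 => T.outer e.1 e.2 = T.outer i x) =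
      {(i, x), (T.refl x i, x)} := by
  ext ⟨j, y⟩
  simp only [Finset.mem_filter, Finset.mem_univ, true_and, outer_eq_outer, Finset.mem_insert,
    Finset.mem_singleton, Prod.mk.injEq]
  tauto

theorem degree_outer (i : Fin n) (x : Fin 3) :
    (T.starGraph ℓ hℓ).degree (.inr (T.outer i x)) = 1 ↔ T.refl x i = i := by
  have : (Finset.univ.filter fun e : Fin n × Fin 3 =>
      (T.starGraph ℓ hℓ).src e = .inr (T.outer i x) ∨
      (T.starGraph ℓ hℓ).tgt e = .inr (T.outer i x)) = {(i, x), (T.refl x i, x)} := by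
    rw [← filter_outer]; ext e; simp
  rw [MetricGraph.degree, this]
  by_cases h : T.refl x i = i
  · simp [h]
  · rw [Finset.card_pair (by simpa using fun h' => h h'.symm)]
    simp [h]

variable {𝕜 : Type} [RCLike 𝕜]

/-- The boundary conditions of a star graph, read off tile by tile. -/
theorem isDSBC_iff {φ : (T.starGraph ℓ hℓ).Point → 𝕜} {dφ ddφ : Fin n × Fin 3 → ℝ → 𝕜} :
    (T.starGraph ℓ hℓ).IsDSBC φ dφ ddφ ↔
      (∀ i x, MetricGraph.EdgeH2 (ℓ x) (fun t => φ ((T.starGraph ℓ hℓ).pointOn (i, x) t))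
        (dφ (i, x)) (ddφ (i, x))) ∧
      (∀ i x, T.refl x i = i → φ (.vertex (.inr (T.outer i x))) = 0) ∧
      (∀ i, ∑ x, dφ (i, x) 0 = 0) ∧
      (∀ i x, T.refl x i ≠ i → dφ (i, x) (ℓ x) + dφ (T.refl x i, x) (ℓ x) = 0) := by
  have hc : ∀ i, (∑ e with (T.starGraph ℓ hℓ).tgt e = .inl i, dφ e ((T.starGraph ℓ hℓ).len e)
      + ∑ e with (T.starGraph ℓ hℓ).src e = .inl i, -dφ e 0 = 0) ↔ ∑ x, dφ (i, x) 0 = 0 := by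
    intro i
    have : (Finset.univ.filter fun e : Fin n × Fin 3 => (T.starGraph ℓ hℓ).src e = .inl i) =
        {i} ×ˢ Finset.univ := by ext ⟨j, y⟩; simp [eq_comm]
    rw [this]
    simp
  have ho : ∀ i x, T.refl x i ≠ i →
      ((∑ e with (T.starGraph ℓ hℓ).tgt e = .inr (T.outer i x), dφ e ((T.starGraph ℓ hℓ).len e)
      + ∑ e with (T.starGraph ℓ hℓ).src e = .inr (T.outer i x), -dφ e 0 = 0) ↔
      dφ (i, x) (ℓ x) + dφ (T.refl x i, x) (ℓ x) = 0) := by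
    intro i x h
    have : (Finset.univ.filter fun e : Fin n × Fin 3 =>
        (T.starGraph ℓ hℓ).tgt e = .inr (T.outer i x)) = {(i, x), (T.refl x i, x)} := by
      rw [← filter_outer]; ext e; simp
    rw [this, Finset.sum_pair (by simpa using fun h' => h h'.symm)]
    simp
  constructor
  · intro H
    exact ⟨fun i x => H.edge (i, x),
      fun i x h => H.dirichlet _ ((T.degree_outer ℓ hℓ i x).2 h),
      fun i => (hc i).1 (H.kirchhoff _ (by rw [degree_center]; decide)),
      fun i x h => (ho i x h).1 (H.kirchhoff _ (mt (T.degree_outer ℓ hℓ i x).1 h))⟩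
  · rintro ⟨h1, h2, h3, h4⟩
    refine ⟨fun e => h1 e.1 e.2, ?_, ?_⟩
    · rintro (i | p) h
      · rw [degree_center] at h; omega
      · rw [T.exists_outer p] at h ⊢
        exact h2 _ _ ((T.degree_outer ℓ hℓ _ _).1 h)
    · rintro (i | p) h
      · exact (hc i).2 (h3 i)
      · rw [T.exists_outer p] at h ⊢
        have h' := mt (T.degree_outer ℓ hℓ _ _).2 h
        exact (ho _ _ h').2 (h4 _ _ h')

theorem ext_point {α : Type} {φ ψ : (T.starGraph ℓ hℓ).Point → α}
    (h : ∀ i x, ∀ t ∈ Set.Icc 0 (ℓ x), φ ((T.starGraph ℓ hℓ).pointOn (i, x) t) =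
      ψ ((T.starGraph ℓ hℓ).pointOn (i, x) t)) : φ = ψ := by
  funext p
  rcases p with (i | p) | ⟨⟨i, x⟩, t, ht⟩
  · have := h i 0 0 ⟨le_rfl, (hℓ 0).le⟩
    rwa [MetricGraph.pointOn_of_nonpos _ _ le_rfl] at this
  · have := h p.1.1 p.1.2 _ ⟨(hℓ _).le, le_rfl⟩
    rw [MetricGraph.pointOn_of_len_le _ _
      (show (T.starGraph ℓ hℓ).len (p.1.1, p.1.2) ≤ ℓ p.1.2 from le_rfl)] at this
    simpa only [starGraph_tgt, ← T.exists_outer p] using this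
  · have := h i x t ⟨ht.1.le, ht.2.le⟩
    rwa [MetricGraph.pointOn_of_mem _ _ ht] at this

/-! ### Transplantation -/

/-- `-1` on the boundary sides and `1` on the interior sides of the tiles. -/
def sideSign (x : Fin 3) (i : Fin n) : ℤ := if T.refl x i = i then -1 else 1

variable {m : ℕ} (T' : Tiling m)

/-- `A` intertwines the signed permutations of the two tilings that describe the reflection of
functions vanishing on the boundary sides. -/
def Intertwines (A : Matrix (Fin m) (Fin n) ℂ) : Prop :=
  ∀ x i j, A i (T.refl x j) * T.sideSign x j = T'.sideSign x i * A (T'.refl x i) j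

variable {T T' ℓ hℓ} {A : Matrix (Fin m) (Fin n) ℂ}

/-- The hypotheses say that `w` is fixed by the signed permutation of the side `x`; the intertwining
relation makes the transplanted vector fixed as well. On a boundary side the sign does not matter
because `w` is `0` there. -/
theorem Intertwines.sum_values (hA : Intertwines T T' A) (x : Fin 3) (i : Fin m) {w : Fin n → ℂ}
    (h0 : ∀ j, T.refl x j = j → w j = 0) (h1 : ∀ j, w (T.refl x j) = w j) :
    ∑ j, A i j * w j = T'.sideSign x i * ∑ j, A (T'.refl x i) j * w j := by
  rw [Finset.mul_sum, ← Equiv.sum_comp (T.refl x)]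
  refine Finset.sum_congr rfl fun j _ => ?_
  rw [h1, ← mul_assoc, ← hA x i j]
  by_cases h : T.refl x j = j
  · simp [h0 j h]
  · simp [sideSign, h]

/-- The counterpart for the eigenvalue `-1`. On a boundary side the sign already is `-1`, so nothing
is required of `w` there, just as Dirichlet ends leave the derivative free. -/
theorem Intertwines.sum_derivs (hA : Intertwines T T' A) (x : Fin 3) (i : Fin m) {w : Fin n → ℂ}
    (h1 : ∀ j, T.refl x j ≠ j → w j + w (T.refl x j) = 0) :
    ∑ j, A i j * w j = -(T'.sideSign x i * ∑ j, A (T'.refl x i) j * w j) := by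
  rw [Finset.mul_sum, ← Equiv.sum_comp (T.refl x), ← Finset.sum_neg_distrib]
  refine Finset.sum_congr rfl fun j _ => ?_
  rw [← mul_assoc, ← hA x i j]
  by_cases h : T.refl x j = j
  · simp [sideSign, h]
  · rw [eq_neg_of_add_eq_zero_right (h1 j h)]
    simp [sideSign, h]

variable (T T' ℓ hℓ A)

/-- The transplantation of functions from one star graph to another: on the tile `i` the new
function is the combination with coefficients `A i j` of the restrictions to the tiles `j`. -/
noncomputable def transplant :
    ((T.starGraph ℓ hℓ).Point → ℂ) →ₗ[ℂ] ((T'.starGraph ℓ hℓ).Point → ℂ) where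
  toFun φ
    | .vertex (.inl i) => ∑ j, A i j * φ (.vertex (.inl j))
    | .vertex (.inr p) => ∑ j, A p.1.1 j * φ (.vertex (.inr (T.outer j p.1.2)))
    | .inner (i, x) t ht => ∑ j, A i j * φ (.inner (j, x) t ht)
  map_add' φ ψ := by
    funext p
    rcases p with (i | p) | ⟨⟨i, x⟩, t, ht⟩ <;> simp [mul_add, Finset.sum_add_distrib]
  map_smul' c φ := by
    funext p
    rcases p with (i | p) | ⟨⟨i, x⟩, t, ht⟩ <;> simp [Finset.mul_sum, mul_left_comm]

variable {T T' ℓ hℓ A}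

/-- At an outer vertex `transplant` uses the smaller of the two tile indices. That the other index
gives the same value needs the Dirichlet condition `h0`. -/
theorem Intertwines.transplant_pointOn (hA : Intertwines T T' A)
    {φ : (T.starGraph ℓ hℓ).Point → ℂ}
    (h0 : ∀ j x, T.refl x j = j → φ (.vertex (.inr (T.outer j x))) = 0)
    (i : Fin m) (x : Fin 3) (t : ℝ) :
    transplant T ℓ hℓ T' A φ ((T'.starGraph ℓ hℓ).pointOn (i, x) t) =
      ∑ j, A i j * φ ((T.starGraph ℓ hℓ).pointOn (j, x) t) := by
  rcases le_or_gt t 0 with ht | ht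
  · simp only [MetricGraph.pointOn_of_nonpos _ _ ht]
    rfl
  rcases le_or_gt (ℓ x) t with ht' | ht'
  · have h1 : ∀ j, (T.starGraph ℓ hℓ).pointOn (j, x) t = .vertex (.inr (T.outer j x)) := fun j =>
      MetricGraph.pointOn_of_len_le _ _ ht'
    rw [MetricGraph.pointOn_of_len_le _ _ (show (T'.starGraph ℓ hℓ).len (i, x) ≤ t from ht')]
    simp only [h1, starGraph_tgt]
    change ∑ j, A (min i (T'.refl x i)) j * φ (.vertex (.inr (T.outer j x))) = _
    rcases min_choice i (T'.refl x i) with h | h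
    · rw [h]
    · by_cases h2 : T'.refl x i = i
      · rw [h, h2]
      · have := hA.sum_values x i (w := fun j => φ (.vertex (.inr (T.outer j x))))
          (fun j hj => h0 j x hj) (fun j => by rw [T.outer_refl])
        simp only [sideSign, if_neg h2, Int.cast_one, one_mul] at this
        rw [h, this]
  · have h1 : ∀ j, (T.starGraph ℓ hℓ).pointOn (j, x) t = .inner (j, x) t ⟨ht, ht'⟩ := fun j =>
      MetricGraph.pointOn_of_mem _ _ _
    rw [MetricGraph.pointOn_of_mem _ _ (show t ∈ Set.Ioo 0 ((T'.starGraph ℓ hℓ).len (i, x)) from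
      ⟨ht, ht'⟩)]
    simp only [h1]
    rfl

theorem Intertwines.solves (hA : Intertwines T T' A) {z : ℂ} {f : Fin n × Fin 3 → ℝ → ℂ}
    {φ : (T.starGraph ℓ hℓ).Point → ℂ} (h : (T.starGraph ℓ hℓ).Solves z f φ) :
    (T'.starGraph ℓ hℓ).Solves z (fun e t => ∑ j, A e.1 j * f (j, e.2) t)
      (transplant T ℓ hℓ T' A φ) := by
  obtain ⟨dφ, ddφ, hD, hz⟩ := h
  obtain ⟨h1, h2, h3, h4⟩ := (T.isDSBC_iff ℓ hℓ).1 hD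
  have key := hA.transplant_pointOn h2
  refine ⟨fun e t => ∑ j, A e.1 j * dφ (j, e.2) t, fun e t => ∑ j, A e.1 j * ddφ (j, e.2) t,
    (T'.isDSBC_iff ℓ hℓ).2 ⟨fun i x => ?_, fun i x hi => ?_, fun i => ?_, fun i x hi => ?_⟩, ?_⟩
  · simp only [key]
    exact MetricGraph.EdgeH2.sum _ _ fun j => h1 j x
  · have e1 := key i x (ℓ x)
    rw [MetricGraph.pointOn_of_len_le _ _
      (show (T'.starGraph ℓ hℓ).len (i, x) ≤ ℓ x from le_rfl)] at e1
    have h5 : ∀ j, (T.starGraph ℓ hℓ).pointOn (j, x) (ℓ x) = .vertex (.inr (T.outer j x)) :=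
      fun j => MetricGraph.pointOn_of_len_le _ _ le_rfl
    simp only [h5, starGraph_tgt] at e1
    -- On a boundary side of the new tile the sign is `-1`, so the transplanted value equals its own
    -- negative.
    have e2 := hA.sum_values x i (w := fun j => φ (.vertex (.inr (T.outer j x))))
      (fun j hj => h2 j x hj) (fun j => by rw [T.outer_refl])
    rw [sideSign, if_pos hi, hi, Int.cast_neg, Int.cast_one, neg_one_mul] at e2
    rw [e1]
    exact self_eq_neg.1 e2
  · simp only
    rw [Finset.sum_comm]
    simp [← Finset.mul_sum, h3]
  · have e2 := hA.sum_derivs x i (w := fun j => dφ (j, x) (ℓ x)) (fun j hj => h4 j x hj)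
    simp only [sideSign, if_neg hi, Int.cast_one, one_mul] at e2
    simp only
    rw [e2]; ring
  · rintro ⟨i, x⟩
    have : ∀ᵐ t ∂(volume.restrict (Set.Icc 0 (ℓ x))), ∀ j,
        -ddφ (j, x) t - z * φ ((T.starGraph ℓ hℓ).pointOn (j, x) t) = f (j, x) t :=
      ae_all_iff.2 fun j => hz (j, x)
    change ∀ᵐ t ∂(volume.restrict (Set.Icc 0 (ℓ x))), _
    filter_upwards [this] with t ht
    rw [key]
    simp only [← ht, Finset.mul_sum, ← Finset.sum_neg_distrib, ← Finset.sum_sub_distrib]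
    exact Finset.sum_congr rfl fun j _ => by ring

theorem solves_dirichlet {z : ℂ} {f : Fin n × Fin 3 → ℝ → ℂ}
    {φ : (T.starGraph ℓ hℓ).Point → ℂ} (h : (T.starGraph ℓ hℓ).Solves z f φ) (j : Fin n)
    (x : Fin 3) (hj : T.refl x j = j) : φ (.vertex (.inr (T.outer j x))) = 0 := by
  obtain ⟨dφ, ddφ, hD, -⟩ := h
  exact ((T.isDSBC_iff ℓ hℓ).1 hD).2.1 j x hj

theorem transplant_transplant {B : Matrix (Fin n) (Fin m) ℂ} (hA : Intertwines T T' A)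
    (hB : Intertwines T' T B) (hBA : B * A = 1) {z : ℂ} {f : Fin n × Fin 3 → ℝ → ℂ}
    {φ : (T.starGraph ℓ hℓ).Point → ℂ} (h : (T.starGraph ℓ hℓ).Solves z f φ) :
    transplant T' ℓ hℓ T B (transplant T ℓ hℓ T' A φ) = φ := by
  refine T.ext_point ℓ hℓ fun i x t _ => ?_
  rw [hB.transplant_pointOn (solves_dirichlet (hA.solves h))]
  simp only [hA.transplant_pointOn (solves_dirichlet h), Finset.mul_sum]
  rw [Finset.sum_comm]
  simp only [← mul_assoc, ← Finset.sum_mul, ← Matrix.mul_apply, hBA]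
  simp [Matrix.one_apply]

/-- If `z` is not in the spectrum of the first graph, a right-hand side on the second graph is
pulled back by `B`, solved there, and the solution is transplanted by `A`. Uniqueness holds because
every solution on the second graph is recovered from its image under `B`. -/
theorem spec_subset {B : Matrix (Fin n) (Fin m) ℂ} (hA : Intertwines T T' A)
    (hB : Intertwines T' T B) (hAB : A * B = 1) :
    (T'.starGraph ℓ hℓ).spec ⊆ (T.starGraph ℓ hℓ).spec := by
  intro z hz hT
  refine hz fun f hf => ?_
  obtain ⟨φ, hφ, hu⟩ := hT (fun e t => ∑ j, B e.1 j * f (j, e.2) t) fun e =>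
    memLp_finsetSum _ fun j _ => (hf (j, e.2)).const_mul _
  refine ⟨transplant T ℓ hℓ T' A φ, ?_, fun ψ hψ => ?_⟩
  · have := hA.solves hφ
    convert this using 1
    funext e t
    simp only [Finset.mul_sum]
    rw [Finset.sum_comm]
    simp only [← mul_assoc, ← Finset.sum_mul, ← Matrix.mul_apply, hAB]
    simp [Matrix.one_apply]
  · rw [← hu _ (hB.solves hψ), transplant_transplant hB hA hAB hψ]

/-- Star graphs of tilings with a transplantation between them are isospectral. -/
theorem isospectral {B : Matrix (Fin n) (Fin m) ℂ} (hA : Intertwines T T' A)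
    (hB : Intertwines T' T B) (hAB : A * B = 1) (hBA : B * A = 1) :
    (T.starGraph ℓ hℓ).Isospectral (T'.starGraph ℓ hℓ) := by
  refine ⟨(spec_subset hB hA hBA).antisymm (spec_subset hA hB hAB), fun z => ?_⟩
  have h0 : ∀ {k l : ℕ} {S : Tiling k} {S' : Tiling l} {C : Matrix (Fin l) (Fin k) ℂ},
      Intertwines S S' C → ∀ φ ∈ (S.starGraph ℓ hℓ).eigenspace z,
      transplant S ℓ hℓ S' C φ ∈ (S'.starGraph ℓ hℓ).eigenspace z := by
    intro k l S S' C hC φ hφ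
    have := hC.solves (f := 0) hφ
    simp only [Pi.zero_apply, mul_zero, Finset.sum_const_zero] at this
    exact this
  exact LinearEquiv.rank_eq
    { toLinearMap := (transplant T ℓ hℓ T' A).restrict (h0 hA)
      invFun := (transplant T' ℓ hℓ T B).restrict (h0 hB)
      left_inv := fun φ => Subtype.ext (transplant_transplant hA hB hBA φ.2)
      right_inv := fun φ => Subtype.ext (transplant_transplant hB hA hAB φ.2) }

end Tiling

/-! ### The transplantation of the pair `7₁` -/

/-- The transplantation matrix of the pair `7₁`. -/
def transplantation71 : Matrix (Fin 7) (Fin 7) ℤ :=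
  !![0, 1, 0, 1, 0, 1, 0; 1, 0, 1, 0, 0, -1, 0; 0, 1, -1, 0, 0, 0, -1; 1, 0, 0, -1, 0, 0, 1;
    0, 0, 0, 0, -1, 1, -1; 1, -1, 0, 0, 1, 0, 0; 0, 0, -1, 1, -1, 0, 0]

/-- Six times the inverse of `transplantation71`. -/
def transplantation71Inv : Matrix (Fin 7) (Fin 7) ℤ :=
  !![1, 2, 1, 2, 1, 2, 1; 2, 1, 2, 1, -1, -2, -1; 1, 2, -2, -1, 1, -1, -2; 2, 1, -1, -2, -1, 1, 2;
    1, -1, 1, -1, -2, 2, -2; 2, -2, -1, 1, 2, 1, -1; 1, -1, -2, 2, -2, -1, 1]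

theorem isospectral71 {a b c : ℝ} (ha : 0 < a) (hb : 0 < b) (hc : 0 < c) :
    (graph71₁ ha hb hc).Isospectral (graph71₂ ha hb hc) := by
  -- The relations are decided over the integers; the factor `6` of the scaled inverse is divided
  -- out only over `ℂ`.
  have h1 : ∀ x i j, transplantation71 i (pair71₁.refl x j) * pair71₁.sideSign x j =
      pair71₂.sideSign x i * transplantation71 (pair71₂.refl x i) j := by decide
  have h2 : ∀ x i j, transplantation71Inv i (pair71₂.refl x j) * pair71₂.sideSign x j =
      pair71₁.sideSign x i * transplantation71Inv (pair71₁.refl x i) j := by decide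
  have h3 : ∀ i j, (transplantation71 * transplantation71Inv) i j = if i = j then 6 else 0 := by
    decide
  have h4 : ∀ i j, (transplantation71Inv * transplantation71) i j = if i = j then 6 else 0 := by
    decide
  let f : ℤ →+* ℂ := Int.castRingHom ℂ
  have h5 : transplantation71.map f * transplantation71Inv.map f = (6 : ℂ) • 1 := by
    rw [← Matrix.map_mul]
    ext i j
    rw [Matrix.map_apply, h3, Matrix.smul_apply, Matrix.one_apply]
    split_ifs <;> simp [f]
  have h6 : transplantation71Inv.map f * transplantation71.map f = (6 : ℂ) • 1 := by
    rw [← Matrix.map_mul]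
    ext i j
    rw [Matrix.map_apply, h4, Matrix.smul_apply, Matrix.one_apply]
    split_ifs <;> simp [f]
  refine Tiling.isospectral (A := transplantation71.map f)
    (B := (6⁻¹ : ℂ) • transplantation71Inv.map f) (fun x i j => ?_) (fun x i j => ?_) ?_ ?_
  · simpa [f] using congrArg f (h1 x i j)
  · have := congrArg f (h2 x i j)
    simp only [map_mul, f, Int.coe_castRingHom] at this
    simp only [Matrix.smul_apply, Matrix.map_apply, f, smul_eq_mul, Int.coe_castRingHom]
    linear_combination 6⁻¹ * this
  · rw [Matrix.mul_smul, h5, smul_smul]; norm_num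
  · rw [Matrix.smul_mul, h6, smul_smul]; norm_num

/-! ### Torsion functions of star graphs -/

theorem MetricGraph.EdgeH2.eq_of_deriv_eq_neg_one {l : ℝ} {f g h : ℝ → ℝ}
    (H : MetricGraph.EdgeH2 l f g h) (hh : ∀ᵐ t ∂(volume.restrict (Set.Icc 0 l)), h t = -1) :
    ∀ t ∈ Set.Icc 0 l, g t = g 0 - t ∧ f t = f 0 + g 0 * t - t ^ 2 / 2 := by
  have h1 : ∀ t ∈ Set.Icc 0 l, g t = g 0 - t := by
    intro t ht
    have : ∫ s in (0 : ℝ)..t, h s = ∫ s in (0 : ℝ)..t, (-1 : ℝ) := by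
      apply intervalIntegral.integral_congr_ae
      filter_upwards [(ae_restrict_iff' measurableSet_Icc).1 hh] with s hs hs'
      rw [Set.uIoc_of_le ht.1] at hs'
      exact hs ⟨hs'.1.le, hs'.2.trans ht.2⟩
    rw [H.deriv_eq t ht, this]
    simp
    ring
  refine fun t ht => ⟨h1 t ht, ?_⟩
  have : ∫ s in (0 : ℝ)..t, g s = ∫ s in (0 : ℝ)..t, (g 0 - s) := by
    apply intervalIntegral.integral_congr
    intro s hs
    rw [Set.uIcc_of_le ht.1] at hs
    exact h1 s ⟨hs.1, hs.2.trans ht.2⟩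
  rw [H.eq t ht, this, intervalIntegral.integral_sub (by simp) (by simp)]
  simp
  ring

theorem MetricGraph.EdgeH2.quadratic {l : ℝ} (hl : 0 ≤ l) {f : ℝ → ℝ} {v s : ℝ}
    (hf : ∀ t ∈ Set.Icc 0 l, f t = v + s * t - t ^ 2 / 2) :
    MetricGraph.EdgeH2 l f (fun t => s - t) (fun _ => -1) where
  memLp := memLp_const _
  deriv_eq t ht := by simp; ring
  eq t ht := by
    rw [hf t ht, hf 0 ⟨le_rfl, hl⟩, intervalIntegral.integral_sub (by simp) (by simp)]
    simp
    ring

namespace Tiling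

variable {n : ℕ} (T : Tiling n) (ℓ : Fin 3 → ℝ) (hℓ : ∀ x, 0 < ℓ x)

/-- The slope at the center `i`, in the direction of the side `x`, of a solution of `Δ u = -1` with
the value `v j` at every center `j`. -/
noncomputable def slope (v : Fin n → ℝ) (i : Fin n) (x : Fin 3) : ℝ :=
  if T.refl x i = i then ℓ x / 2 - v i / ℓ x else ℓ x + (v (T.refl x i) - v i) / (2 * ℓ x)

variable {T ℓ} in
theorem slope_end_of_fixed {v : Fin n → ℝ} {i : Fin n} {x : Fin 3} (hx : 0 < ℓ x)
    (h : T.refl x i = i) : v i + T.slope ℓ v i x * ℓ x - ℓ x ^ 2 / 2 = 0 := by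
  rw [slope, if_pos h]
  field_simp
  ring

variable {T ℓ} in
theorem slope_end_of_moved {v : Fin n → ℝ} {i : Fin n} {x : Fin 3} (hx : 0 < ℓ x)
    (h : T.refl x i ≠ i) : v i + T.slope ℓ v i x * ℓ x - ℓ x ^ 2 / 2 =
      (v i + v (T.refl x i)) / 2 + ℓ x ^ 2 / 2 := by
  rw [slope, if_neg h]
  field_simp
  ring

/-- The solutions of `Δ u = -1` on a star graph correspond to the solutions of a linear system for
the values at the centers. -/
theorem isTorsionFunction_iff {u : (T.starGraph ℓ hℓ).Point → ℝ} :
    (T.starGraph ℓ hℓ).IsTorsionFunction u ↔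
      (∀ i, ∑ x, T.slope ℓ (fun j => u (.vertex (.inl j))) i x = 0) ∧
      ∀ i x, ∀ t ∈ Set.Icc 0 (ℓ x), u ((T.starGraph ℓ hℓ).pointOn (i, x) t) =
        u (.vertex (.inl i)) + T.slope ℓ (fun j => u (.vertex (.inl j))) i x * t - t ^ 2 / 2 := by
  set v : Fin n → ℝ := fun j => u (.vertex (.inl j)) with hv
  have hs : ∀ i x, u ((T.starGraph ℓ hℓ).pointOn (i, x) 0) = v i := fun i x => by
    rw [MetricGraph.pointOn_of_nonpos _ _ le_rfl]; rfl
  have he : ∀ i x, u ((T.starGraph ℓ hℓ).pointOn (i, x) (ℓ x)) =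
      u (.vertex (.inr (T.outer i x))) := fun i x => by
    rw [MetricGraph.pointOn_of_len_le _ _
      (show (T.starGraph ℓ hℓ).len (i, x) ≤ ℓ x from le_rfl)]
    rfl
  constructor
  · rintro ⟨dφ, ddφ, hD, hz⟩
    obtain ⟨h1, h2, h3, h4⟩ := (T.isDSBC_iff ℓ hℓ).1 hD
    have h5 : ∀ i x, ∀ t ∈ Set.Icc 0 (ℓ x), dφ (i, x) t = dφ (i, x) 0 - t ∧
        u ((T.starGraph ℓ hℓ).pointOn (i, x) t) = v i + dφ (i, x) 0 * t - t ^ 2 / 2 := by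
      intro i x t ht
      have := (h1 i x).eq_of_deriv_eq_neg_one (by
        have hz' : ∀ᵐ t ∂(volume.restrict (Set.Icc 0 (ℓ x))), _ := hz (i, x)
        filter_upwards [hz'] with t ht
        linarith) t ht
      rwa [hs] at this
    have h6 : ∀ i x, dφ (i, x) 0 = T.slope ℓ v i x := by
      intro i x
      have hx := hℓ x
      have e1 := (h5 i x _ ⟨hx.le, le_rfl⟩).2
      rw [he] at e1
      unfold slope
      split_ifs with h
      · rw [h2 i x h] at e1
        field_simp
        linarith
      · have e2 := (h5 (T.refl x i) x _ ⟨hx.le, le_rfl⟩).2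
        rw [he, T.outer_refl] at e2
        have e3 := h4 i x h
        rw [(h5 i x _ ⟨hx.le, le_rfl⟩).1, (h5 (T.refl x i) x _ ⟨hx.le, le_rfl⟩).1] at e3
        field_simp
        linear_combination e2 - e1 + ℓ x * e3
    exact ⟨fun i => by simp only [← h6, h3], fun i x t ht => by rw [← h6]; exact (h5 i x t ht).2⟩
  · rintro ⟨h1, h2⟩
    refine ⟨fun e t => T.slope ℓ v e.1 e.2 - t, fun _ _ => -1, (T.isDSBC_iff ℓ hℓ).2
      ⟨fun i x => .quadratic (hℓ x).le (h2 i x), fun i x h => ?_, fun i => by simpa using h1 i,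
        fun i x h => ?_⟩, fun e => by simp⟩
    · rw [← he, h2 i x _ ⟨(hℓ x).le, le_rfl⟩]
      exact slope_end_of_fixed (v := v) (hℓ x) h
    · have hx := hℓ x
      simp only [slope, T.invol, if_neg h, if_neg (Ne.symm h)]
      field_simp
      ring

/-- The function with the value `v i` at the center `i` that solves `Δ u = -1` if the slopes at
every center add up to zero. -/
noncomputable def torsionFun (v : Fin n → ℝ) : (T.starGraph ℓ hℓ).Point → ℝ
  | .vertex (.inl i) => v i
  | .vertex (.inr p) => v p.1.1 + T.slope ℓ v p.1.1 p.1.2 * ℓ p.1.2 - ℓ p.1.2 ^ 2 / 2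
  | .inner (i, x) t _ => v i + T.slope ℓ v i x * t - t ^ 2 / 2

theorem torsionFun_pointOn (v : Fin n → ℝ) (i : Fin n) (x : Fin 3) (t : ℝ)
    (ht : t ∈ Set.Icc 0 (ℓ x)) : T.torsionFun ℓ hℓ v ((T.starGraph ℓ hℓ).pointOn (i, x) t) =
      v i + T.slope ℓ v i x * t - t ^ 2 / 2 := by
  rcases ht.1.eq_or_lt with rfl | h0
  · rw [MetricGraph.pointOn_of_nonpos _ _ le_rfl]
    simp [torsionFun]
  rcases ht.2.eq_or_lt with rfl | h1
  · rw [MetricGraph.pointOn_of_len_le _ _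
      (show (T.starGraph ℓ hℓ).len (i, x) ≤ ℓ x from le_rfl)]
    -- The value stored at the outer vertex is computed from the smaller index. At an interior side
    -- the end value is symmetric in the two tiles, so the choice is harmless.
    change v (min i (T.refl x i)) + T.slope ℓ v (min i (T.refl x i)) x * ℓ x - ℓ x ^ 2 / 2 = _
    rcases min_choice i (T.refl x i) with h | h
    · rw [h]
    · by_cases h2 : T.refl x i = i
      · rw [h, h2]
      · rw [h, slope_end_of_moved h0 h2, slope_end_of_moved h0 (by rw [T.invol]; exact Ne.symm h2),
          T.invol, add_comm (v i)]
  · rw [MetricGraph.pointOn_of_mem _ _ (show t ∈ Set.Ioo 0 ((T.starGraph ℓ hℓ).len (i, x)) from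
      ⟨h0, h1⟩)]
    rfl

variable {T ℓ hℓ}

theorem isTorsionFunction_torsionFun {v : Fin n → ℝ} (hv : ∀ i, ∑ x, T.slope ℓ v i x = 0) :
    (T.starGraph ℓ hℓ).IsTorsionFunction (T.torsionFun ℓ hℓ v) :=
  (T.isTorsionFunction_iff ℓ hℓ).2 ⟨hv, T.torsionFun_pointOn ℓ hℓ v⟩

/-- Energy argument: pairing the difference of the two systems with `d = v - w` gives minus a sum of
squares, so `d` is constant across interior sides and zero at tiles with a boundary side.
Connectedness and one boundary side give `d = 0`. -/
theorem eq_of_sum_slope_eq_zero (hT : ∃ i x, T.refl x i = i) (hℓ : ∀ x, 0 < ℓ x)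
    {v w : Fin n → ℝ} (hv : ∀ i, ∑ x, T.slope ℓ v i x = 0) (hw : ∀ i, ∑ x, T.slope ℓ w i x = 0) :
    v = w := by
  set d : Fin n → ℝ := fun i => v i - w i with hd
  have h1 : ∀ x, ∑ i, (T.slope ℓ v i x - T.slope ℓ w i x) * d i = -∑ i,
      if T.refl x i = i then d i ^ 2 / ℓ x else (d (T.refl x i) - d i) ^ 2 / (4 * ℓ x) := by
    intro x
    have hx := hℓ x
    have h2 := Equiv.sum_comp (T.refl x)
      fun i => (T.slope ℓ v i x - T.slope ℓ w i x) * d i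
    -- Summation by parts: adding the sum to its reindexing by the reflection combines the two terms
    -- at an interior side into a square. Counting twice explains the factor `-2` and the `4` in the
    -- denominator.
    have h3 : ∑ i, (T.slope ℓ v i x - T.slope ℓ w i x) * d i +
        ∑ i, (T.slope ℓ v (T.refl x i) x - T.slope ℓ w (T.refl x i) x) * d (T.refl x i) =
        -2 * ∑ i, if T.refl x i = i then d i ^ 2 / ℓ x else
          (d (T.refl x i) - d i) ^ 2 / (4 * ℓ x) := by
      rw [← Finset.sum_add_distrib, Finset.mul_sum]
      refine Finset.sum_congr rfl fun i _ => ?_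
      by_cases h : T.refl x i = i
      · simp only [slope, h, if_true, hd]
        field_simp
        ring
      · simp only [slope, T.invol, if_neg h, if_neg (Ne.symm h), hd]
        field_simp
        ring
    linarith
  have h4 : ∑ x, ∑ i, (if T.refl x i = i then d i ^ 2 / ℓ x else
      (d (T.refl x i) - d i) ^ 2 / (4 * ℓ x)) = 0 := by
    have : ∑ i, (∑ x, T.slope ℓ v i x - ∑ x, T.slope ℓ w i x) * d i = 0 := by simp [hv, hw]
    simp only [← Finset.sum_sub_distrib, Finset.sum_mul] at this
    rw [Finset.sum_comm] at this
    simp only [h1, Finset.sum_neg_distrib] at this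
    linarith
  have h5 : ∀ x i, 0 ≤ (if T.refl x i = i then d i ^ 2 / ℓ x else
      (d (T.refl x i) - d i) ^ 2 / (4 * ℓ x)) := fun x i => by
    have := hℓ x
    split_ifs <;> positivity
  have h6 : ∀ x i, (if T.refl x i = i then d i ^ 2 / ℓ x else
      (d (T.refl x i) - d i) ^ 2 / (4 * ℓ x)) = 0 := fun x i =>
    (Finset.sum_eq_zero_iff_of_nonneg fun i _ => h5 x i).1
      ((Finset.sum_eq_zero_iff_of_nonneg fun x _ => Finset.sum_nonneg fun i _ => h5 x i).1 h4 x
        (Finset.mem_univ _)) i (Finset.mem_univ _)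
  have h7 : ∀ x i, d (T.refl x i) = d i := fun x i => by
    have := h6 x i
    have hx := hℓ x
    split_ifs at this with h
    · rw [h]
    · have := (div_eq_zero_iff.1 this).resolve_right (by positivity)
      linarith [pow_eq_zero_iff (two_ne_zero) |>.1 this]
  obtain ⟨i₀, x₀, h0⟩ := hT
  have h8 : d i₀ = 0 := by
    have := h6 x₀ i₀
    rw [if_pos h0] at this
    exact pow_eq_zero_iff two_ne_zero |>.1 ((div_eq_zero_iff.1 this).resolve_right (hℓ x₀).ne')
  funext i
  have h9 : d i = d i₀ := by
    obtain ⟨p⟩ := T.connected.preconnected i i₀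
    induction p with
    | nil => rfl
    | cons h _ ih =>
      rw [← ih h0 h8]
      obtain ⟨-, ⟨x, rfl⟩ | ⟨x, rfl⟩⟩ := h
      · exact (h7 _ _).symm
      · exact h7 _ _
  have : v i - w i = 0 := by rw [← h8, ← h9]
  linarith

theorem IsTorsionFunction.eq_torsionFun (hT : ∃ i x, T.refl x i = i) {v : Fin n → ℝ}
    (hv : ∀ i, ∑ x, T.slope ℓ v i x = 0) {u : (T.starGraph ℓ hℓ).Point → ℝ}
    (hu : (T.starGraph ℓ hℓ).IsTorsionFunction u) : u = T.torsionFun ℓ hℓ v := by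
  obtain ⟨h1, h2⟩ := (T.isTorsionFunction_iff ℓ hℓ).1 hu
  have h3 := eq_of_sum_slope_eq_zero hT hℓ h1 hv
  refine T.ext_point ℓ hℓ fun i x t ht => ?_
  rw [h2 i x t ht, h3, torsionFun_pointOn T ℓ hℓ v i x t ht, ← h3]

theorem integral_torsionFun (v : Fin n → ℝ) :
    (T.starGraph ℓ hℓ).integral (T.torsionFun ℓ hℓ v) =
      ∑ i, ∑ x, (v i * ℓ x + T.slope ℓ v i x * ℓ x ^ 2 / 2 - ℓ x ^ 3 / 6) := by
  rw [MetricGraph.integral, Fintype.sum_prod_type]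
  refine Finset.sum_congr rfl fun i _ => Finset.sum_congr rfl fun x _ => ?_
  rw [intervalIntegral.integral_congr
    (g := fun t => v i + T.slope ℓ v i x * t - t ^ 2 / 2) fun t ht => by
      rw [starGraph_len, Set.uIcc_of_le (hℓ x).le] at ht
      exact T.torsionFun_pointOn ℓ hℓ v i x t ht]
  rw [intervalIntegral.integral_sub ((by fun_prop : Continuous _).intervalIntegrable _ _)
    ((by fun_prop : Continuous _).intervalIntegrable _ _),
    intervalIntegral.integral_add (by simp) ((by fun_prop : Continuous _).intervalIntegrable _ _),
    intervalIntegral.integral_const_mul]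
  simp
  ring

end Tiling

/-! ### The torsion functions of the pair `7₁` -/

/-- Numerator of the value at the center of the tile `0` of the torsion function of the first graph. -/
noncomputable def torsionNumer (a b c : ℝ) : ℝ :=
  56 * b ^ 4 * c ^ 6 + 112 * b ^ 5 * c ^ 5 + 48 * b ^ 6 * c ^ 4 + 216 * a * b ^ 3 * c ^ 6 +
    736 * a * b ^ 4 * c ^ 5 + 718 * a * b ^ 5 * c ^ 4 + 200 * a * b ^ 6 * c ^ 3 +
    312 * a ^ 2 * b ^ 2 * c ^ 6 + 1627 * a ^ 2 * b ^ 3 * c ^ 5 + 2604 * a ^ 2 * b ^ 4 * c ^ 4 +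
    1609 * a ^ 2 * b ^ 5 * c ^ 3 + 312 * a ^ 2 * b ^ 6 * c ^ 2 + 200 * a ^ 3 * b * c ^ 6 +
    1609 * a ^ 3 * b ^ 2 * c ^ 5 + 7711/2 * a ^ 3 * b ^ 3 * c ^ 4 +
    7711/2 * a ^ 3 * b ^ 4 * c ^ 3 + 1627 * a ^ 3 * b ^ 5 * c ^ 2 + 216 * a ^ 3 * b ^ 6 * c +
    48 * a ^ 4 * c ^ 6 + 718 * a ^ 4 * b * c ^ 5 + 2604 * a ^ 4 * b ^ 2 * c ^ 4 +
    7711/2 * a ^ 4 * b ^ 3 * c ^ 3 + 2604 * a ^ 4 * b ^ 4 * c ^ 2 + 736 * a ^ 4 * b ^ 5 * c +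
    56 * a ^ 4 * b ^ 6 + 112 * a ^ 5 * c ^ 5 + 736 * a ^ 5 * b * c ^ 4 +
    1627 * a ^ 5 * b ^ 2 * c ^ 3 + 1609 * a ^ 5 * b ^ 3 * c ^ 2 + 718 * a ^ 5 * b ^ 4 * c +
    112 * a ^ 5 * b ^ 5 + 56 * a ^ 6 * c ^ 4 + 216 * a ^ 6 * b * c ^ 3 +
    312 * a ^ 6 * b ^ 2 * c ^ 2 + 200 * a ^ 6 * b ^ 3 * c + 48 * a ^ 6 * b ^ 4

/-- Numerator of the value at the center of the tile `1` of the torsion function of the first graph. -/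
noncomputable def torsionNumerNear (a b c : ℝ) : ℝ :=
  32 * a * b ^ 3 * c ^ 6 + 132 * a * b ^ 4 * c ^ 5 + 160 * a * b ^ 5 * c ^ 4 +
    56 * a * b ^ 6 * c ^ 3 + 88 * a ^ 2 * b ^ 2 * c ^ 6 + 524 * a ^ 2 * b ^ 3 * c ^ 5 +
    1006 * a ^ 2 * b ^ 4 * c ^ 4 + 731 * a ^ 2 * b ^ 5 * c ^ 3 + 168 * a ^ 2 * b ^ 6 * c ^ 2 +
    80 * a ^ 3 * b * c ^ 6 + 706 * a ^ 3 * b ^ 2 * c ^ 5 + 3971/2 * a ^ 3 * b ^ 3 * c ^ 4 +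
    4549/2 * a ^ 3 * b ^ 4 * c ^ 3 + 1091 * a ^ 3 * b ^ 5 * c ^ 2 + 168 * a ^ 3 * b ^ 6 * c +
    24 * a ^ 4 * c ^ 6 + 378 * a ^ 4 * b * c ^ 5 + 1594 * a ^ 4 * b ^ 2 * c ^ 4 +
    5325/2 * a ^ 4 * b ^ 3 * c ^ 3 + 1996 * a ^ 4 * b ^ 4 * c ^ 2 + 632 * a ^ 4 * b ^ 5 * c +
    56 * a ^ 4 * b ^ 6 + 64 * a ^ 5 * c ^ 5 + 496 * a ^ 5 * b * c ^ 4 +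
    1225 * a ^ 5 * b ^ 2 * c ^ 3 + 1327 * a ^ 5 * b ^ 3 * c ^ 2 + 646 * a ^ 5 * b ^ 4 * c +
    112 * a ^ 5 * b ^ 5 + 40 * a ^ 6 * c ^ 4 + 168 * a ^ 6 * b * c ^ 3 +
    264 * a ^ 6 * b ^ 2 * c ^ 2 + 184 * a ^ 6 * b ^ 3 * c + 48 * a ^ 6 * b ^ 4

/-- Numerator of the value at the center of the tile `2` of the torsion function of the first graph. -/
noncomputable def torsionNumerFar (a b c : ℝ) : ℝ :=
  16 * a * b ^ 3 * c ^ 6 + 68 * a * b ^ 4 * c ^ 5 + 88 * a * b ^ 5 * c ^ 4 +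
    32 * a * b ^ 6 * c ^ 3 + 56 * a ^ 2 * b ^ 2 * c ^ 6 + 304 * a ^ 2 * b ^ 3 * c ^ 5 +
    532 * a ^ 2 * b ^ 4 * c ^ 4 + 340 * a ^ 2 * b ^ 5 * c ^ 3 + 64 * a ^ 2 * b ^ 6 * c ^ 2 +
    64 * a ^ 3 * b * c ^ 6 + 478 * a ^ 3 * b ^ 2 * c ^ 5 + 2273/2 * a ^ 3 * b ^ 3 * c ^ 4 +
    2109/2 * a ^ 3 * b ^ 4 * c ^ 3 + 368 * a ^ 3 * b ^ 5 * c ^ 2 + 32 * a ^ 3 * b ^ 6 * c +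
    24 * a ^ 4 * c ^ 6 + 306 * a ^ 4 * b * c ^ 5 + 1046 * a ^ 4 * b ^ 2 * c ^ 4 +
    2687/2 * a ^ 4 * b ^ 3 * c ^ 3 + 698 * a ^ 4 * b ^ 4 * c ^ 2 + 116 * a ^ 4 * b ^ 5 * c +
    64 * a ^ 5 * c ^ 5 + 392 * a ^ 5 * b * c ^ 4 + 713 * a ^ 5 * b ^ 2 * c ^ 3 +
    509 * a ^ 5 * b ^ 3 * c ^ 2 + 124 * a ^ 5 * b ^ 4 * c + 40 * a ^ 6 * c ^ 4 +
    120 * a ^ 6 * b * c ^ 3 + 120 * a ^ 6 * b ^ 2 * c ^ 2 + 40 * a ^ 6 * b ^ 3 * c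

/-- The common denominator of the values of the torsion function at the centers. -/
noncomputable def torsionDenom (a b c : ℝ) : ℝ := (a * b + b * c + c * a) * torsionD a b c

theorem torsionD_pos {a b c : ℝ} (ha : 0 < a) (hb : 0 < b) (hc : 0 < c) :
    0 < torsionD a b c := by
  unfold torsionD
  positivity

theorem torsionN_neg {a b c : ℝ} (ha : 0 < a) (hb : 0 < b) (hc : 0 < c) :
    torsionN a b c < 0 := by
  unfold torsionN
  rw [neg_mul, neg_mul]
  exact neg_neg_of_pos (by positivity)

theorem torsionDenom_pos {a b c : ℝ} (ha : 0 < a) (hb : 0 < b) (hc : 0 < c) :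
    0 < torsionDenom a b c :=
  mul_pos (by positivity) (torsionD_pos ha hb hc)

theorem torsionDenom_rotate (a b c : ℝ) : torsionDenom b c a = torsionDenom a b c := by
  unfold torsionDenom torsionD
  ring

theorem torsionDenom_swap (a b c : ℝ) : torsionDenom a c b = torsionDenom a b c := by
  unfold torsionDenom torsionD
  ring

theorem torsionNumer_rotate (a b c : ℝ) : torsionNumer b c a = torsionNumer a b c := by
  unfold torsionNumer
  ring

/-- The Kirchhoff condition at the center of the tile `0`, multiplied by `2 * a * b * c` and the
common denominator. The next two identities do the same for the inner and the outer tile of a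
branch. -/
theorem torsionNumer_balance (a b c : ℝ) :
    2 * a * b * c * (a + b + c) * torsionDenom a b c +
      a * b * (torsionNumerNear a b c - torsionNumer a b c) +
      a * c * (torsionNumerNear c a b - torsionNumer a b c) +
      b * c * (torsionNumerNear b c a - torsionNumer a b c) = 0 := by
  unfold torsionDenom torsionD torsionNumer torsionNumerNear
  ring

theorem torsionNumerNear_balance (a b c : ℝ) :
    2 * a * b * c * (a / 2 + b + c) * torsionDenom a b c +
      a * b * (torsionNumer a b c - torsionNumerNear a b c) +
      a * c * (torsionNumerFar a b c - torsionNumerNear a b c) -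
      2 * b * c * torsionNumerNear a b c = 0 := by
  unfold torsionDenom torsionD torsionNumer torsionNumerNear torsionNumerFar
  ring

theorem torsionNumerFar_balance (a b c : ℝ) :
    2 * a * b * c * (a / 2 + b + c / 2) * torsionDenom a b c +
      a * c * (torsionNumerNear a b c - torsionNumerFar a b c) -
      2 * b * c * torsionNumerFar a b c - 2 * a * b * torsionNumerFar a b c = 0 := by
  unfold torsionDenom torsionD torsionNumerNear torsionNumerFar
  ring

/-- The values of the torsion function of the first graph at the centers. -/
noncomputable def torsionCenter (a b c : ℝ) (i : Fin 7) : ℝ :=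
  ![torsionNumer a b c, torsionNumerNear a b c, torsionNumerFar a b c, torsionNumerNear c a b,
    torsionNumerFar c a b, torsionNumerNear b c a, torsionNumerFar b c a] i / torsionDenom a b c

theorem torsionCenter_balance {a b c : ℝ} (ha : 0 < a) (hb : 0 < b) (hc : 0 < c) :
    let v := torsionCenter a b c
    c + (v 1 - v 0) / (2 * c) + (b + (v 3 - v 0) / (2 * b)) + (a + (v 5 - v 0) / (2 * a)) = 0 := by
  have hK := torsionDenom_pos ha hb hc
  have h := torsionNumer_balance a b c
  simp only [torsionCenter, Matrix.cons_val]
  field_simp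
  linear_combination h

theorem torsionCenter_near_far {a b c : ℝ} (ha : 0 < a) (hb : 0 < b) (hc : 0 < c) :
    let K := torsionDenom a b c
    let u := torsionNumer a b c / K
    let v := torsionNumerNear a b c / K
    let w := torsionNumerFar a b c / K
    a / 2 - v / a + (b + (w - v) / (2 * b)) + (c + (u - v) / (2 * c)) = 0 ∧
    a / 2 - w / a + (b + (v - w) / (2 * b)) + (c / 2 - w / c) = 0 := by
  have hK := torsionDenom_pos ha hb hc
  have h := torsionNumerNear_balance a b c
  have h' := torsionNumerFar_balance a b c
  constructor
  · field_simp
    linear_combination h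
  · field_simp
    linear_combination h'

theorem sum_slope_pair71₁ {a b c : ℝ} (ha : 0 < a) (hb : 0 < b) (hc : 0 < c) (i : Fin 7) :
    ∑ x, pair71₁.slope ![a, b, c] (torsionCenter a b c) i x = 0 := by
  have h0 := torsionCenter_balance ha hb hc
  -- The three branches, with tiles `1, 2`, then `3, 4`, then `5, 6`, are related by cyclic
  -- permutation of the labels.
  obtain ⟨h1, h2⟩ := torsionCenter_near_far ha hb hc
  obtain ⟨h3, h4⟩ := torsionCenter_near_far hc ha hb
  obtain ⟨h5, h6⟩ := torsionCenter_near_far hb hc ha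
  rw [torsionDenom_rotate, torsionNumer_rotate] at h5
  rw [torsionDenom_rotate] at h6
  rw [← torsionDenom_rotate c a b, ← torsionNumer_rotate c a b] at h3
  rw [← torsionDenom_rotate c a b] at h4
  fin_cases i <;>
    simp [Fin.sum_univ_three, Tiling.slope, pair71₁, torsionCenter, Equiv.swap_apply_def] at * <;>
    linarith

theorem sum_slope_pair71₂ {a b c : ℝ} (ha : 0 < a) (hb : 0 < b) (hc : 0 < c) (i : Fin 7) :
    ∑ x, pair71₂.slope ![a, b, c] (torsionCenter a c b) i x = 0 := by
  -- Interchanging the labels `b` and `c` together with their lengths turns the second system into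
  -- the first.
  have h : ∀ x, pair71₂.refl x = pair71₁.refl (Equiv.swap 1 2 x) := by decide
  have h' : ∀ x, (![a, b, c] : Fin 3 → ℝ) x = (![a, c, b] : Fin 3 → ℝ) (Equiv.swap 1 2 x) := by
    intro x; fin_cases x <;> rfl
  have := sum_slope_pair71₁ ha hc hb i
  rw [← Equiv.sum_comp (Equiv.swap 1 2)] at this
  rw [← this]
  refine Finset.sum_congr rfl fun x _ => ?_
  simp only [Tiling.slope, h, h']

/-- The torsional rigidity of the first graph. -/
theorem integral_pair71₁ {a b c : ℝ} (ha : 0 < a) (hb : 0 < b) (hc : 0 < c) :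
    ∑ i, ∑ x, (torsionCenter a b c i * ![a, b, c] x +
        pair71₁.slope ![a, b, c] (torsionCenter a b c) i x * ![a, b, c] x ^ 2 / 2 -
        ![a, b, c] x ^ 3 / 6) =
      19 / 12 * (a ^ 3 + b ^ 3 + c ^ 3) + ((a + b + c) * torsionNumer a b c +
      ((a / 2 + b + c) * torsionNumerNear a b c + (a / 2 + b + c / 2) * torsionNumerFar a b c) +
      ((c / 2 + a + b) * torsionNumerNear c a b + (c / 2 + a + b / 2) * torsionNumerFar c a b) +
      ((b / 2 + c + a) * torsionNumerNear b c a + (b / 2 + c + a / 2) * torsionNumerFar b c a)) /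
        torsionDenom a b c := by
  have hK := torsionDenom_pos ha hb hc
  -- After cancellation of the value differences across interior sides, an interior edge contributes
  -- `v * ℓ + ℓ ^ 3 / 3` and a boundary edge `v * ℓ / 2 + ℓ ^ 3 / 12`. Every label has four interior
  -- and three boundary edges, and `4 / 3 + 3 / 12 = 19 / 12`.
  simp [Fin.sum_univ_three, Fin.sum_univ_seven, Tiling.slope, pair71₁, torsionCenter,
    Equiv.swap_apply_def]
  field_simp
  ring

theorem integral_pair71₂ {a b c : ℝ} :
    ∑ i, ∑ x, (torsionCenter a c b i * ![a, b, c] x +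
        pair71₂.slope ![a, b, c] (torsionCenter a c b) i x * ![a, b, c] x ^ 2 / 2 -
        ![a, b, c] x ^ 3 / 6) =
    ∑ i, ∑ x, (torsionCenter a c b i * ![a, c, b] x +
        pair71₁.slope ![a, c, b] (torsionCenter a c b) i x * ![a, c, b] x ^ 2 / 2 -
        ![a, c, b] x ^ 3 / 6) := by
  have h : ∀ x, pair71₂.refl x = pair71₁.refl (Equiv.swap 1 2 x) := by decide
  have h' : ∀ x, (![a, b, c] : Fin 3 → ℝ) x = (![a, c, b] : Fin 3 → ℝ) (Equiv.swap 1 2 x) := by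
    intro x; fin_cases x <;> rfl
  refine Finset.sum_congr rfl fun i _ => ?_
  rw [← Equiv.sum_comp (Equiv.swap 1 2) fun x => torsionCenter a c b i * ![a, c, b] x + _ - _]
  refine Finset.sum_congr rfl fun x _ => ?_
  simp only [Tiling.slope, h, h']

/-- The first numerator is cyclic in the labels, so its difference under a transposition is
alternating, hence divisible by the Vandermonde product. The factor `a * b + b * c + c * a` cancels
against `torsionDenom`. -/
theorem torsionNumer_difference (a b c : ℝ) :
    ((a + b + c) * torsionNumer a b c +
      ((a / 2 + b + c) * torsionNumerNear a b c + (a / 2 + b + c / 2) * torsionNumerFar a b c) +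
      ((c / 2 + a + b) * torsionNumerNear c a b + (c / 2 + a + b / 2) * torsionNumerFar c a b) +
      ((b / 2 + c + a) * torsionNumerNear b c a + (b / 2 + c + a / 2) * torsionNumerFar b c a)) -
    ((a + c + b) * torsionNumer a c b +
      ((a / 2 + c + b) * torsionNumerNear a c b + (a / 2 + c + b / 2) * torsionNumerFar a c b) +
      ((b / 2 + a + c) * torsionNumerNear b a c + (b / 2 + a + c / 2) * torsionNumerFar b a c) +
      ((c / 2 + b + a) * torsionNumerNear c b a + (c / 2 + b + a / 2) * torsionNumerFar c b a)) =
    (a - b) * (a - c) * (b - c) * torsionN a b c * (a * b + b * c + c * a) := by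
  unfold torsionN torsionNumer torsionNumerNear torsionNumerFar
  ring

theorem isTorsionFunction71₁_iff {a b c : ℝ} (ha : 0 < a) (hb : 0 < b) (hc : 0 < c)
    {u : (graph71₁ ha hb hc).Point → ℝ} : (graph71₁ ha hb hc).IsTorsionFunction u ↔
      u = pair71₁.torsionFun ![a, b, c] (lengths_pos ha hb hc) (torsionCenter a b c) := by
  have hv := sum_slope_pair71₁ ha hb hc
  constructor
  · exact fun h => Tiling.IsTorsionFunction.eq_torsionFun ⟨1, 0, by decide⟩ hv h
  · rintro rfl
    exact Tiling.isTorsionFunction_torsionFun hv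

theorem isTorsionFunction71₂_iff {a b c : ℝ} (ha : 0 < a) (hb : 0 < b) (hc : 0 < c)
    {u : (graph71₂ ha hb hc).Point → ℝ} : (graph71₂ ha hb hc).IsTorsionFunction u ↔
      u = pair71₂.torsionFun ![a, b, c] (lengths_pos ha hb hc) (torsionCenter a c b) := by
  have hv := sum_slope_pair71₂ ha hb hc
  constructor
  · exact fun h => Tiling.IsTorsionFunction.eq_torsionFun ⟨1, 0, by decide⟩ hv h
  · rintro rfl
    exact Tiling.isTorsionFunction_torsionFun hv

theorem integral71_sub {a b c : ℝ} (ha : 0 < a) (hb : 0 < b) (hc : 0 < c)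
    {u₁ : (graph71₁ ha hb hc).Point → ℝ} {u₂ : (graph71₂ ha hb hc).Point → ℝ}
    (h₁ : (graph71₁ ha hb hc).IsTorsionFunction u₁)
    (h₂ : (graph71₂ ha hb hc).IsTorsionFunction u₂) :
    (graph71₁ ha hb hc).integral u₁ - (graph71₂ ha hb hc).integral u₂ =
      (a - b) * (a - c) * (b - c) * (torsionN a b c / torsionD a b c) := by
  rw [(isTorsionFunction71₁_iff ha hb hc).1 h₁, (isTorsionFunction71₂_iff ha hb hc).1 h₂]
  unfold graph71₁ graph71₂
  rw [Tiling.integral_torsionFun, Tiling.integral_torsionFun, integral_pair71₂,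
    integral_pair71₁ ha hb hc, integral_pair71₁ ha hc hb, torsionDenom_swap a b c]
  have hD := torsionD_pos ha hb hc
  have he : 0 < a * b + b * c + c * a := by positivity
  have hK := torsionDenom_pos ha hb hc
  have h := torsionNumer_difference a b c
  have : (a - b) * (a - c) * (b - c) * (torsionN a b c / torsionD a b c) =
      (a - b) * (a - c) * (b - c) * torsionN a b c * (a * b + b * c + c * a) /
        torsionDenom a b c := by
    unfold torsionDenom
    field_simp
  rw [this, ← h]
  ring

/-! ### Branch points -/

/-- A point that has, in arbitrarily small balls, three points whose mutual distances are at least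
the radius of the ball. In a metric graph these are the vertices of degree at least three. -/
def IsBranchPoint {X : Type} [PseudoEMetricSpace X] (p : X) : Prop :=
  ∀ R : ℝ≥0, 0 < R → ∃ r < R, ∃ q : Fin 3 → X, (∀ k, edist p (q k) < r) ∧
    ∀ k l, k ≠ l → r ≤ edist (q k) (q l)

theorem IsBranchPoint.map {X Y : Type} [PseudoEMetricSpace X] [PseudoEMetricSpace Y] (e : X ≃ᵢ Y)
    {p : X} (hp : IsBranchPoint p) : IsBranchPoint (e p) := by
  intro R hR
  obtain ⟨r, hr, q, h1, h2⟩ := hp R hR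
  exact ⟨r, hr, e ∘ q, by simpa [e.isometry.edist_eq] using h1,
    by simpa [e.isometry.edist_eq] using h2⟩

namespace MetricGraph

variable {V E : Type} (G : MetricGraph V E)

theorem edist_pointOn_le (e : E) {s t : ℝ} (hs : s ∈ Set.Icc 0 (G.len e))
    (ht : t ∈ Set.Icc 0 (G.len e)) : edist (G.pointOn e s) (G.pointOn e t) ≤ edist s t := by
  rw [edist_nndist]
  exact iInf₂_le _ (by simpa using Route.cons e s t hs ht (.nil _))

theorem edist_lt_iff {p q : G.Point} {r : ℝ≥0∞} :
    edist p q < r ↔ ∃ L : ℝ≥0, G.Route p q L ∧ L < r := by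
  change (⨅ (L : ℝ≥0) (_ : G.Route p q L), (L : ℝ≥0∞)) < r ↔ _
  simp [iInf_lt_iff]

/-- The source of all lower bounds for the path metric: a function that is 1-Lipschitz on every edge
is 1-Lipschitz along every route. -/
theorem lipschitzWith_one_of_edges {h : G.Point → ℝ}
    (H : ∀ e, ∀ s ∈ Set.Icc 0 (G.len e), ∀ t ∈ Set.Icc 0 (G.len e),
      |h (G.pointOn e s) - h (G.pointOn e t)| ≤ |s - t|) (p q : G.Point) :
    edist (h p) (h q) ≤ edist p q := by
  refine le_iInf₂ fun L hL => ?_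
  rw [edist_nndist, ENNReal.coe_le_coe]
  induction hL with
  | nil p => simp
  | cons e s t hs ht _ ih =>
    refine (nndist_triangle _ (h (G.pointOn e t)) _).trans (add_le_add ?_ ih)
    exact H e s hs t ht

end MetricGraph

namespace Tiling

variable {n : ℕ} (T : Tiling n) (ℓ : Fin 3 → ℝ) (hℓ : ∀ x, 0 < ℓ x)

theorem pointOn_zero (i : Fin n) (x : Fin 3) :
    (T.starGraph ℓ hℓ).pointOn (i, x) 0 = .vertex (.inl i) :=
  MetricGraph.pointOn_of_nonpos _ _ le_rfl

theorem pointOn_end (i : Fin n) (x : Fin 3) :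
    (T.starGraph ℓ hℓ).pointOn (i, x) (ℓ x) = .vertex (.inr (T.outer i x)) :=
  MetricGraph.pointOn_of_len_le _ _ le_rfl

theorem pointOn_inner (i : Fin n) (x : Fin 3) {t : ℝ} (ht : t ∈ Set.Ioo 0 (ℓ x)) :
    (T.starGraph ℓ hℓ).pointOn (i, x) t = .inner (i, x) t ht :=
  MetricGraph.pointOn_of_mem _ _ _

theorem pointOn_eq_pointOn {i j : Fin n} {x y : Fin 3} {s t : ℝ} (hs : s ∈ Set.Icc 0 (ℓ y))
    (ht : t ∈ Set.Ioc 0 (ℓ x))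
    (h : (T.starGraph ℓ hℓ).pointOn (j, y) s = (T.starGraph ℓ hℓ).pointOn (i, x) t) :
    y = x ∧ s = t ∧ (j = i ∨ j = T.refl x i ∧ t = ℓ x) := by
  rcases hs.1.eq_or_lt with rfl | h0
  · rw [pointOn_zero] at h
    rcases ht.2.eq_or_lt with rfl | h1
    · rw [pointOn_end] at h; simp at h
    · rw [T.pointOn_inner ℓ hℓ i x ⟨ht.1, h1⟩] at h; simp at h
  · rcases hs.2.eq_or_lt with rfl | h2 <;> rcases ht.2.eq_or_lt with rfl | h1
    · rw [pointOn_end, pointOn_end] at h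
      simp only [MetricGraph.Point.vertex.injEq, Sum.inr.injEq, outer_eq_outer] at h
      obtain ⟨rfl, h⟩ := h
      simpa using h
    · rw [pointOn_end, T.pointOn_inner ℓ hℓ i x ⟨ht.1, h1⟩] at h; simp at h
    · rw [pointOn_end, T.pointOn_inner ℓ hℓ j y ⟨h0, h2⟩] at h; simp at h
    · rw [T.pointOn_inner ℓ hℓ i x ⟨ht.1, h1⟩, T.pointOn_inner ℓ hℓ j y ⟨h0, h2⟩] at h
      obtain ⟨h3, h4⟩ := MetricGraph.Point.inner.inj h
      obtain ⟨rfl, rfl⟩ := Prod.mk.inj h3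
      exact ⟨rfl, h4, .inl rfl⟩

/-- The two edges that meet at the outer vertex on the side `x` of the tile `i`, parametrized by
`(-ℓ x, ℓ x)` with this vertex at `0`; for a side on the boundary the edge is covered twice. -/
noncomputable def line (i : Fin n) (x : Fin 3) (τ : ℝ) : (T.starGraph ℓ hℓ).Point :=
  if τ ≤ 0 then (T.starGraph ℓ hℓ).pointOn (i, x) (ℓ x + τ)
  else (T.starGraph ℓ hℓ).pointOn (T.refl x i, x) (ℓ x - τ)

theorem line_of_nonpos (i : Fin n) (x : Fin 3) {τ : ℝ} (h : τ ≤ 0) :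
    T.line ℓ hℓ i x τ = (T.starGraph ℓ hℓ).pointOn (i, x) (ℓ x + τ) := if_pos h

theorem line_of_nonneg (i : Fin n) (x : Fin 3) {τ : ℝ} (h : 0 ≤ τ) :
    T.line ℓ hℓ i x τ = (T.starGraph ℓ hℓ).pointOn (T.refl x i, x) (ℓ x - τ) := by
  rcases h.eq_or_lt with rfl | h
  · rw [line_of_nonpos T ℓ hℓ i x le_rfl, add_zero, sub_zero, pointOn_end, pointOn_end, outer_refl]
  · exact if_neg h.not_ge

variable {T ℓ hℓ}

/-- A route of length less than `ℓ x - |τ|` cannot reach a center, so it lifts to the parameter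
interval. Passing the outer vertex just continues to the other half of `line`. -/
theorem exists_line_of_route {i : Fin n} {x : Fin 3} {p q : (T.starGraph ℓ hℓ).Point} {L : ℝ≥0}
    (h : (T.starGraph ℓ hℓ).Route p q L) : ∀ τ, p = T.line ℓ hℓ i x τ → |τ| + L < ℓ x →
      ∃ τ', |τ - τ'| ≤ L ∧ q = T.line ℓ hℓ i x τ' := by
  induction h with
  | nil p => exact fun τ hp _ => ⟨τ, by simp, hp⟩
  | @cons e s t hs ht q L _ ih =>
    intro τ hp hL
    obtain ⟨j, y⟩ := e
    rw [starGraph_len] at hs ht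
    have hL0 : (0 : ℝ) ≤ L := L.2
    push_cast [coe_nndist, Real.dist_eq] at hL ⊢
    have hst := abs_nonneg (s - t)
    have hτ : |τ| < ℓ x := by linarith
    have step : ∃ τ₁, (T.starGraph ℓ hℓ).pointOn (j, y) t = T.line ℓ hℓ i x τ₁ ∧
        |τ - τ₁| = |s - t| := by
      have first : y = x → j = i → s = ℓ x + τ → ∃ τ₁, (T.starGraph ℓ hℓ).pointOn (j, y) t =
          T.line ℓ hℓ i x τ₁ ∧ |τ - τ₁| = |s - t| := by
        rintro rfl rfl rfl
        refine ⟨t - ℓ y, ?_, by congr 1; ring⟩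
        rw [line_of_nonpos _ _ _ _ _ (by linarith [ht.2])]
        congr 1; ring
      have second : y = x → j = T.refl x i → s = ℓ x - τ → ∃ τ₁,
          (T.starGraph ℓ hℓ).pointOn (j, y) t =
          T.line ℓ hℓ i x τ₁ ∧ |τ - τ₁| = |s - t| := by
        rintro rfl rfl rfl
        refine ⟨ℓ y - t, ?_, by rw [← abs_neg]; congr 1; ring⟩
        rw [line_of_nonneg _ _ _ _ _ (by linarith [ht.2])]
        congr 1; ring
      rcases le_total τ 0 with h0 | h0
      · rw [abs_of_nonpos h0] at hτ
        rw [line_of_nonpos _ _ _ _ _ h0] at hp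
        obtain ⟨e1, e2, e3⟩ := T.pointOn_eq_pointOn ℓ hℓ hs ⟨by linarith, by linarith⟩ hp
        rcases e3 with e3 | ⟨e3, e4⟩
        · exact first e1 e3 e2
        · exact second e1 e3 (by linarith)
      · rw [abs_of_nonneg h0] at hτ
        rw [line_of_nonneg _ _ _ _ _ h0] at hp
        obtain ⟨e1, e2, e3⟩ := T.pointOn_eq_pointOn ℓ hℓ hs ⟨by linarith, by linarith⟩ hp
        rcases e3 with e3 | ⟨e3, e4⟩
        · exact second e1 e3 e2
        · exact first e1 (by rw [e3, T.invol]) (by linarith)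
    obtain ⟨τ₁, e1, e2⟩ := step
    obtain ⟨τ', h1, h2⟩ := ih τ₁ e1 (by
      have := abs_sub_abs_le_abs_sub τ₁ τ
      rw [abs_sub_comm] at this
      linarith)
    exact ⟨τ', (abs_sub_le τ τ₁ τ').trans (by linarith), h2⟩

theorem edist_line_le {i : Fin n} {x : Fin 3} {τ τ' : ℝ} (h : |τ| < ℓ x) (h' : |τ'| < ℓ x) :
    edist (T.line ℓ hℓ i x τ) (T.line ℓ hℓ i x τ') ≤ edist τ τ' := by
  have hx := hℓ x
  have neg : ∀ a b : ℝ, |a| < ℓ x → |b| < ℓ x → a ≤ 0 → b ≤ 0 →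
      edist (T.line ℓ hℓ i x a) (T.line ℓ hℓ i x b) ≤ edist a b := by
    intro a b ha hb ha0 hb0
    rw [abs_lt] at ha hb
    rw [line_of_nonpos _ _ _ _ _ ha0, line_of_nonpos _ _ _ _ _ hb0]
    refine ((T.starGraph ℓ hℓ).edist_pointOn_le (i, x) (s := ℓ x + a) (t := ℓ x + b)
      ⟨by linarith, ?_⟩ ⟨by linarith, ?_⟩).trans_eq (by simp)
    · rw [starGraph_len]; linarith
    · rw [starGraph_len]; linarith
  have pos : ∀ a b : ℝ, |a| < ℓ x → |b| < ℓ x → 0 ≤ a → 0 ≤ b →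
      edist (T.line ℓ hℓ i x a) (T.line ℓ hℓ i x b) ≤ edist a b := by
    intro a b ha hb ha0 hb0
    rw [abs_lt] at ha hb
    rw [line_of_nonneg _ _ _ _ _ ha0, line_of_nonneg _ _ _ _ _ hb0]
    refine ((T.starGraph ℓ hℓ).edist_pointOn_le (T.refl x i, x) (s := ℓ x - a) (t := ℓ x - b)
      ⟨by linarith, ?_⟩ ⟨by linarith, ?_⟩).trans_eq (by simp)
    · rw [starGraph_len]; linarith
    · rw [starGraph_len]; linarith
  have mixed : ∀ a b : ℝ, |a| < ℓ x → |b| < ℓ x → a ≤ 0 → 0 ≤ b →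
      edist (T.line ℓ hℓ i x a) (T.line ℓ hℓ i x b) ≤ edist a b := by
    intro a b ha hb ha0 hb0
    refine (edist_triangle _ (T.line ℓ hℓ i x 0) _).trans ((add_le_add
      (neg a 0 ha (by simpa) ha0 le_rfl) (pos 0 b (by simpa) hb le_rfl hb0)).trans_eq ?_)
    rw [edist_dist, edist_dist, edist_dist, ← ENNReal.ofReal_add dist_nonneg dist_nonneg]
    simp only [Real.dist_eq]
    rw [abs_of_nonpos (by linarith), abs_of_nonpos (by linarith), abs_of_nonpos (by linarith)]
    congr 1; ring
  rcases le_total τ 0 with h0 | h0 <;> rcases le_total τ' 0 with h1 | h1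
  · exact neg _ _ h h' h0 h1
  · exact mixed _ _ h h' h0 h1
  · rw [edist_comm, edist_comm τ]; exact mixed _ _ h' h h1 h0
  · exact pos _ _ h h' h0 h1

/-- Near such a point the graph is the image of an interval under a map that does not increase
distances. Of three points in a ball of radius `r`, two have parameters on the same side of `τ` and
so are closer than `r`. This also covers the folded line at a boundary side. -/
theorem not_isBranchPoint_line {i : Fin n} {x : Fin 3} {τ : ℝ} (h : |τ| < ℓ x) :
    ¬ IsBranchPoint (T.line ℓ hℓ i x τ) := by
  intro hb
  obtain ⟨r, hr, q, h1, h2⟩ := hb (ℓ x - |τ|).toNNReal (by simpa using h)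
  have hr' : |τ| + r < ℓ x := by
    have := Real.lt_toNNReal_iff_coe_lt.1 hr
    linarith
  have h3 : ∀ k, ∃ τ', |τ - τ'| < r ∧ q k = T.line ℓ hℓ i x τ' := by
    intro k
    obtain ⟨L, hL, hLr⟩ := (MetricGraph.edist_lt_iff _).1 (h1 k)
    have hLr' : (L : ℝ) < r := by exact_mod_cast hLr
    obtain ⟨τ', h4, h5⟩ := exists_line_of_route hL τ rfl (by linarith)
    exact ⟨τ', h4.trans_lt hLr', h5⟩
  choose σ h4 h5 using h3
  have h6 : ∀ k, |σ k| < ℓ x := fun k => by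
    have := abs_sub_abs_le_abs_sub (σ k) τ
    rw [abs_sub_comm] at this
    linarith [h4 k]
  have h7 : ∀ k l, k ≠ l → r ≤ |σ k - σ l| := by
    intro k l hkl
    have := h2 k l hkl
    rw [h5, h5] at this
    have := this.trans (edist_line_le (h6 k) (h6 l))
    rw [edist_nndist, ENNReal.coe_le_coe] at this
    exact this
  have h8 : ∀ k l, k ≠ l → ¬ (σ k ≤ τ ∧ σ l ≤ τ) ∧ ¬ (τ ≤ σ k ∧ τ ≤ σ l) := by
    intro k l hkl
    have a1 := abs_lt.1 (h4 k)
    have a2 := abs_lt.1 (h4 l)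
    constructor <;> rintro ⟨b1, b2⟩ <;> refine (h7 k l hkl).not_gt (abs_lt.2 ⟨?_, ?_⟩) <;> linarith
  have h01 := h8 0 1 (by decide)
  have h02 := h8 0 2 (by decide)
  have h12 := h8 1 2 (by decide)
  rcases le_total (σ 0) τ with a0 | a0 <;> rcases le_total (σ 1) τ with a1 | a1 <;>
    rcases le_total (σ 2) τ with a2 | a2 <;> tauto

theorem eq_center_of_isBranchPoint {p : (T.starGraph ℓ hℓ).Point} (hp : IsBranchPoint p) :
    ∃ i, p = .vertex (.inl i) := by
  rcases p with (i | p) | ⟨⟨i, x⟩, t, ht⟩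
  · exact ⟨i, rfl⟩
  · refine absurd hp ?_
    rw [T.exists_outer p, ← T.pointOn_end ℓ hℓ]
    have := not_isBranchPoint_line (T := T) (hℓ := hℓ) (i := p.1.1) (x := p.1.2) (τ := 0)
      (by simpa using hℓ _)
    rwa [line_of_nonpos _ _ _ _ _ le_rfl, add_zero] at this
  · refine absurd hp ?_
    rw [starGraph_len] at ht
    have := not_isBranchPoint_line (T := T) (hℓ := hℓ) (i := i) (x := x) (τ := t - ℓ x)
      (by rw [abs_lt]; constructor <;> linarith [ht.1, ht.2])
    rwa [line_of_nonpos _ _ _ _ _ (by linarith [ht.2]), add_sub_cancel,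
      T.pointOn_inner ℓ hℓ i x ht] at this

variable (T ℓ hℓ)

/-- The function equal to `c e` times a tent of height and half-width `t` on the edge `e`. -/
noncomputable def tent (c : Fin n × Fin 3 → ℝ) (t : ℝ) : (T.starGraph ℓ hℓ).Point → ℝ
  | .vertex _ => 0
  | .inner e s _ => c e * max 0 (t - |s - t|)

variable {T ℓ hℓ}

theorem tent_pointOn (c : Fin n × Fin 3 → ℝ) {t : ℝ} (ht : 0 ≤ t) {i : Fin n} {x : Fin 3}
    (hx : 2 * t ≤ ℓ x) {s : ℝ} (hs : s ∈ Set.Icc 0 (ℓ x)) :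
    T.tent ℓ hℓ c t ((T.starGraph ℓ hℓ).pointOn (i, x) s) = c (i, x) * max 0 (t - |s - t|) := by
  rcases hs.1.eq_or_lt with rfl | h0
  · rw [pointOn_zero]
    simp [tent, abs_of_nonneg ht]
  rcases hs.2.eq_or_lt with rfl | h1
  · rw [pointOn_end, abs_of_nonneg (by linarith), max_eq_left (by linarith)]
    simp [tent]
  · rw [T.pointOn_inner ℓ hℓ i x ⟨h0, h1⟩]
    rfl

/-- The three points at distance `t` from the center on its edges have mutual distances at least `2
* t`, so the radius `r = 2 * t` works. -/
theorem isBranchPoint_center (i : Fin n) :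
    IsBranchPoint (X := (T.starGraph ℓ hℓ).Point) (.vertex (.inl i)) := by
  intro R hR
  have hR' : (0 : ℝ) < R := hR
  obtain ⟨t, ht, htR, htℓ⟩ : ∃ t : ℝ, 0 < t ∧ 2 * t < R ∧ ∀ x, 2 * t ≤ ℓ x := by
    refine ⟨min (R / 3) (min (ℓ 0 / 2) (min (ℓ 1 / 2) (ℓ 2 / 2))), ?_, ?_, ?_⟩
    · have := hℓ 0
      have := hℓ 1
      have := hℓ 2
      positivity
    · linarith [min_le_left (R / 3 : ℝ) (min (ℓ 0 / 2) (min (ℓ 1 / 2) (ℓ 2 / 2)))]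
    · intro x
      have : min (R / 3 : ℝ) (min (ℓ 0 / 2) (min (ℓ 1 / 2) (ℓ 2 / 2))) ≤ ℓ x / 2 := by
        fin_cases x <;> simp
      linarith
  have hmem : ∀ x, t ∈ Set.Icc 0 (ℓ x) := fun x => ⟨ht.le, by linarith [htℓ x]⟩
  obtain ⟨r, hr⟩ : ∃ r : ℝ≥0, (r : ℝ) = 2 * t := ⟨_, Real.coe_toNNReal (2 * t) (by positivity)⟩
  refine ⟨r, by rw [← NNReal.coe_lt_coe, hr]; exact htR,
    fun x => (T.starGraph ℓ hℓ).pointOn (i, x) t, fun x => ?_, fun x y hxy => ?_⟩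
  · rw [← T.pointOn_zero ℓ hℓ i x]
    refine ((T.starGraph ℓ hℓ).edist_pointOn_le (i, x) ⟨le_rfl, (hℓ x).le⟩ (hmem x)).trans_lt ?_
    rw [edist_nndist, ENNReal.coe_lt_coe, ← NNReal.coe_lt_coe, coe_nndist, Real.dist_eq, zero_sub,
      abs_neg, abs_of_pos ht, hr]
    linarith
  -- Test function for the lower bound: a tent on edge `x`, a negative tent on edge `y`. It vanishes
  -- at all vertices since `2 * t ≤ ℓ`, is 1-Lipschitz, and takes the values `t` and `-t` at the two
  -- points.
  · set c : Fin n × Fin 3 → ℝ := fun e => if e = (i, x) then 1 else if e = (i, y) then -1 else 0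
    have hc : ∀ e, |c e| ≤ 1 := fun e => by
      simp only [c]
      split_ifs <;> simp
    have key := (T.starGraph ℓ hℓ).lipschitzWith_one_of_edges (h := T.tent ℓ hℓ c t)
      (by
        rintro ⟨j, z⟩ s hs s' hs'
        rw [tent_pointOn c ht.le (htℓ z) hs, tent_pointOn c ht.le (htℓ z) hs', ← mul_sub, abs_mul]
        refine (mul_le_of_le_one_left (abs_nonneg _) (hc _)).trans ?_
        refine (abs_max_sub_max_le_max _ _ _ _).trans ?_
        rw [sub_zero, abs_zero, max_eq_right (abs_nonneg _), sub_sub_sub_cancel_left]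
        refine (abs_abs_sub_abs_le _ _).trans_eq ?_
        rw [← abs_neg]
        congr 1; ring)
      ((T.starGraph ℓ hℓ).pointOn (i, x) t) ((T.starGraph ℓ hℓ).pointOn (i, y) t)
    rw [tent_pointOn c ht.le (htℓ x) (hmem x), tent_pointOn c ht.le (htℓ y) (hmem y)] at key
    refine le_trans ?_ key
    rw [edist_nndist, ENNReal.coe_le_coe, ← NNReal.coe_le_coe, coe_nndist, Real.dist_eq, hr]
    have : ¬ y = x := fun h => hxy h.symm
    simp only [c, Prod.mk.injEq, true_and, if_true, if_neg this, sub_self, abs_zero, sub_zero,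
      max_eq_right ht.le]
    refine le_trans ?_ (le_abs_self _)
    linarith

/-! ### Distances between centers -/

variable (T ℓ hℓ)

/-- The function with the values `h i` at the centers that is affine between them. -/
noncomputable def affineExtension (h : Fin n → ℝ) : (T.starGraph ℓ hℓ).Point → ℝ
  | .vertex (.inl i) => h i
  | .vertex (.inr p) => (h p.1.1 + h (T.refl p.1.2 p.1.1)) / 2
  | .inner (i, x) t _ => h i + (h (T.refl x i) - h i) / (2 * ℓ x) * t

variable {T ℓ hℓ}

theorem affineExtension_pointOn (h : Fin n → ℝ) {i : Fin n} {x : Fin 3} {s : ℝ}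
    (hs : s ∈ Set.Icc 0 (ℓ x)) :
    T.affineExtension ℓ hℓ h ((T.starGraph ℓ hℓ).pointOn (i, x) s) =
      h i + (h (T.refl x i) - h i) / (2 * ℓ x) * s := by
  rcases hs.1.eq_or_lt with rfl | h0
  · rw [pointOn_zero]
    simp [affineExtension]
  rcases hs.2.eq_or_lt with rfl | h1
  · rw [pointOn_end]
    change (h (min i (T.refl x i)) + h (T.refl x (min i (T.refl x i)))) / 2 = _
    rcases min_choice i (T.refl x i) with e | e <;> rw [e]
    · field_simp; ring
    · rw [T.invol]; field_simp; ring
  · rw [T.pointOn_inner ℓ hℓ i x ⟨h0, h1⟩]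
    rfl

/-- Adjacent centers are joined by a segment of length `2 * ℓ x`, so the bound `H` makes the affine
extension of `h` 1-Lipschitz on every edge. -/
theorem edist_le_edist_centers {h : Fin n → ℝ} (H : ∀ i x, |h (T.refl x i) - h i| ≤ 2 * ℓ x)
    (i j : Fin n) : edist (h i) (h j) ≤
      edist (α := (T.starGraph ℓ hℓ).Point) (.vertex (.inl i)) (.vertex (.inl j)) := by
  refine (T.starGraph ℓ hℓ).lipschitzWith_one_of_edges (h := T.affineExtension ℓ hℓ h)
    ?_ (.vertex (.inl i)) (.vertex (.inl j))
  rintro ⟨k, x⟩ s hs t ht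
  have hx := hℓ x
  rw [affineExtension_pointOn h hs, affineExtension_pointOn h ht, add_sub_add_left_eq_sub,
    ← mul_sub, abs_mul]
  refine mul_le_of_le_one_left (abs_nonneg _) ?_
  rw [abs_div, abs_of_pos (by positivity : 0 < 2 * ℓ x), div_le_one (by positivity)]
  exact H k x

theorem edist_center_refl_le (i : Fin n) (x : Fin 3) :
    edist (α := (T.starGraph ℓ hℓ).Point) (.vertex (.inl i)) (.vertex (.inl (T.refl x i))) ≤
      ENNReal.ofReal (2 * ℓ x) := by
  have hx := hℓ x
  have h1 : ∀ j, edist (α := (T.starGraph ℓ hℓ).Point) (.vertex (.inl j))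
      (.vertex (.inr (T.outer j x))) ≤ ENNReal.ofReal (ℓ x) := by
    intro j
    rw [← T.pointOn_zero ℓ hℓ j x, ← T.pointOn_end ℓ hℓ j x]
    refine ((T.starGraph ℓ hℓ).edist_pointOn_le (j, x) ⟨le_rfl, hx.le⟩ ⟨hx.le, le_rfl⟩).trans_eq ?_
    rw [edist_dist, Real.dist_eq, zero_sub, abs_neg, abs_of_pos hx]
  have h2 := h1 (T.refl x i)
  rw [outer_refl, edist_comm] at h2
  rw [two_mul, ENNReal.ofReal_add hx.le hx.le]
  exact (edist_triangle _ _ _).trans (add_le_add (h1 i) h2)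

/-- Distances between centers, computed from the numbers `N y i j` of sides `y` crossed on the way
from the tile `i` to the tile `j`. -/
theorem edist_centers {N : Fin 3 → Fin n → Fin n → ℕ} (h0 : ∀ y i, N y i i = 0)
    (h1 : ∀ i j, i ≠ j → ∃ x, ∀ y, N y i j = N y i (T.refl x j) + if y = x then 1 else 0)
    (h2 : ∀ x y i j, N y i j ≤ N y i (T.refl x j) + if y = x then 1 else 0) (i j : Fin n) :
    edist (α := (T.starGraph ℓ hℓ).Point) (.vertex (.inl i)) (.vertex (.inl j)) =
      ENNReal.ofReal (∑ y, 2 * N y i j * ℓ y) := by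
  have hnn : ∀ k, 0 ≤ ∑ y, 2 * (N y i k : ℝ) * ℓ y := fun k =>
    Finset.sum_nonneg fun y _ => mul_nonneg (by positivity) (hℓ y).le
  have hsum : ∀ x k, ∑ y, 2 * ((N y i k : ℝ) + if y = x then 1 else 0) * ℓ y =
      ∑ y, 2 * (N y i k : ℝ) * ℓ y + 2 * ℓ x := by
    intro x k
    simp [mul_add, add_mul, Finset.sum_add_distrib]
  apply le_antisymm
  -- Upper bound: `h1` supplies a neighbour of `j` one crossing closer to `i`; induction runs on the
  -- number of crossings.
  · induction hm : ∑ y, N y i j using Nat.strong_induction_on generalizing j with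
    | _ m ih =>
      by_cases hij : i = j
      · subst hij; simp
      obtain ⟨x, hx⟩ := h1 i j hij
      have hlt : ∑ y, N y i (T.refl x j) < m := by
        rw [← hm, Finset.sum_congr rfl fun y _ => hx y, Finset.sum_add_distrib]
        simp
      refine (edist_triangle _ (.vertex (.inl (T.refl x j))) _).trans ?_
      have h3 := edist_center_refl_le (T := T) (hℓ := hℓ) (T.refl x j) x
      rw [T.invol] at h3
      refine (add_le_add (ih _ hlt (T.refl x j) rfl) h3).trans_eq ?_
      rw [← ENNReal.ofReal_add (hnn _) (by linarith [hℓ x]), ← hsum]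
      congr 1
      exact Finset.sum_congr rfl fun y _ => by rw [hx y]; push_cast; rfl
  · have hle : ∀ x k, ∑ y, 2 * (N y i k : ℝ) * ℓ y ≤
        ∑ y, 2 * (N y i (T.refl x k) : ℝ) * ℓ y + 2 * ℓ x := by
      intro x k
      rw [← hsum]
      refine Finset.sum_le_sum fun y _ => ?_
      have : (N y i k : ℝ) ≤ N y i (T.refl x k) + if y = x then 1 else 0 := by
        exact_mod_cast h2 x y i k
      have := hℓ y
      gcongr
    -- Lower bound: the claimed distance from `i` is itself the test function. Applying `h2` at `k`
    -- and at its mirror image bounds its jump in both directions.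
    have key := edist_le_edist_centers (T := T) (hℓ := hℓ)
      (h := fun k => ∑ y, 2 * (N y i k : ℝ) * ℓ y) (fun k x => by
        have e1 := hle x k
        have e2 := hle x (T.refl x k)
        rw [T.invol] at e2
        rw [abs_le]
        constructor <;> linarith) i j
    refine le_trans (le_of_eq ?_) key
    simp only [h0]
    rw [edist_dist, Real.dist_eq]
    simp only [Nat.cast_zero, mul_zero, zero_mul, Finset.sum_const_zero, zero_sub, abs_neg,
      abs_of_nonneg (hnn j)]

end Tiling

/-! ### The two graphs are not isometric -/

/-- The parts of the first domain of the pair `7₁` that are cut off from the copy `0` by the two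
interior sides with a given label. -/
def cutOff71 : Fin 3 → Fin 2 → Finset (Fin 7) :=
  ![![{5, 6}, {4}], ![{3, 4}, {2}], ![{1, 2}, {6}]]

/-- The number of sides with the label `y` on the way from the copy `i` to the copy `j` in the first
domain of the pair `7₁`. -/
def crossings71 (y : Fin 3) (i j : Fin 7) : ℕ :=
  ∑ k, if i ∈ cutOff71 y k ↔ j ∈ cutOff71 y k then 0 else 1

theorem edist_centers71₁ {a b c : ℝ} (ha : 0 < a) (hb : 0 < b) (hc : 0 < c) (i j : Fin 7) :
    edist (α := (graph71₁ ha hb hc).Point) (.vertex (.inl i)) (.vertex (.inl j)) =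
      ENNReal.ofReal (2 * (crossings71 0 i j * a + crossings71 1 i j * b +
        crossings71 2 i j * c)) := by
  refine (Tiling.edist_centers (N := crossings71) (by decide) (by decide) (by decide) i j).trans ?_
  congr 1
  simp [Fin.sum_univ_three]
  ring

theorem edist_centers71₂ {a b c : ℝ} (ha : 0 < a) (hb : 0 < b) (hc : 0 < c) (i j : Fin 7) :
    edist (α := (graph71₂ ha hb hc).Point) (.vertex (.inl i)) (.vertex (.inl j)) =
      ENNReal.ofReal (2 * (crossings71 0 i j * a + crossings71 2 i j * b +
        crossings71 1 i j * c)) := by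
  refine (Tiling.edist_centers (N := fun y => crossings71 (Equiv.swap 1 2 y)) (by decide)
    (by decide) (by decide) i j).trans ?_
  congr 1
  simp [Fin.sum_univ_three, Equiv.swap_apply_def]
  ring

/-- The cube is the lowest power that can separate the graphs: the sum for the first is cyclic in
`a, b, c`, so the difference is alternating and vanishes in degree below `3`. -/
theorem sum_cubes_crossings71 (a b c : ℝ) :
    ∑ i, ∑ j, (crossings71 0 i j * a + crossings71 1 i j * b + crossings71 2 i j * c) ^ 3 -
      ∑ i, ∑ j, (crossings71 0 i j * a + crossings71 2 i j * b + crossings71 1 i j * c) ^ 3 =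
      12 * ((a - b) * (a - c) * (b - c)) := by
  simp [Fin.sum_univ_seven, crossings71, cutOff71]
  ring

theorem isEmpty_isometryEquiv71 {a b c : ℝ} (ha : 0 < a) (hb : 0 < b) (hc : 0 < c) (hab : a ≠ b)
    (hac : a ≠ c) (hbc : b ≠ c) :
    IsEmpty ((graph71₁ ha hb hc).Point ≃ᵢ (graph71₂ ha hb hc).Point) := by
  refine ⟨fun e => ?_⟩
  have h1 : ∀ i : Fin 7, ∃ j : Fin 7, e (.vertex (.inl i)) = .vertex (.inl j) := fun i =>
    Tiling.eq_center_of_isBranchPoint ((Tiling.isBranchPoint_center i).map e)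
  choose f hf using h1
  have hinj : Function.Injective f := fun i j hij => by
    have := e.injective (a₁ := .vertex (.inl i)) (a₂ := .vertex (.inl j)) (by rw [hf, hf, hij])
    simpa using this
  -- An isometry preserves branch points, hence permutes the seven centers. Sums over all pairs of
  -- centers then agree, against the identity for cubes.
  let σ : Equiv.Perm (Fin 7) := Equiv.ofBijective f (Finite.injective_iff_bijective.1 hinj)
  have h2 : ∀ i j, (crossings71 0 i j * a + crossings71 1 i j * b + crossings71 2 i j * c : ℝ) =
      crossings71 0 (σ i) (σ j) * a + crossings71 2 (σ i) (σ j) * b +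
        crossings71 1 (σ i) (σ j) * c := by
    intro i j
    have := e.isometry.edist_eq (.vertex (.inl i)) (.vertex (.inl j))
    rw [hf, hf, edist_centers71₁, edist_centers71₂,
      ENNReal.ofReal_eq_ofReal_iff (by positivity) (by positivity)] at this
    simp only [σ, Equiv.ofBijective_apply]
    linarith
  have h3 := sum_cubes_crossings71 a b c
  simp only [h2] at h3
  rw [Equiv.sum_comp σ fun i => ∑ j, (crossings71 0 i (σ j) * a + crossings71 2 i (σ j) * b +
    crossings71 1 i (σ j) * c : ℝ) ^ 3] at h3
  have h4 : ∀ i, ∑ j, (crossings71 0 i (σ j) * a + crossings71 2 i (σ j) * b +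
      crossings71 1 i (σ j) * c : ℝ) ^ 3 = ∑ j, (crossings71 0 i j * a + crossings71 2 i j * b +
      crossings71 1 i j * c : ℝ) ^ 3 := fun i =>
    Equiv.sum_comp σ fun j => (crossings71 0 i j * a + crossings71 2 i j * b +
      crossings71 1 i j * c : ℝ) ^ 3
  simp only [h4, sub_self] at h3
  have := mul_ne_zero (mul_ne_zero (sub_ne_zero.2 hab) (sub_ne_zero.2 hac)) (sub_ne_zero.2 hbc)
  exact this (by linarith)

theorem theorem1 (a b c : ℝ) (ha : 0 < a) (hb : 0 < b) (hc : 0 < c) :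
    (graph71₁ ha hb hc).Isospectral (graph71₂ ha hb hc) ∧
    (∃! u, (graph71₁ ha hb hc).IsTorsionFunction u) ∧
    (∃! u, (graph71₂ ha hb hc).IsTorsionFunction u) ∧
    torsionN a b c < 0 ∧ 0 < torsionD a b c ∧
    (∀ u₁ u₂, (graph71₁ ha hb hc).IsTorsionFunction u₁ →
      (graph71₂ ha hb hc).IsTorsionFunction u₂ →
      (graph71₁ ha hb hc).integral u₁ - (graph71₂ ha hb hc).integral u₂ =
        (a - b) * (a - c) * (b - c) * (torsionN a b c / torsionD a b c)) ∧
    (a ≠ b → a ≠ c → b ≠ c →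
      IsEmpty ((graph71₁ ha hb hc).Point ≃ᵢ (graph71₂ ha hb hc).Point) ∧
      ∀ u₁ u₂, (graph71₁ ha hb hc).IsTorsionFunction u₁ →
        (graph71₂ ha hb hc).IsTorsionFunction u₂ →
        (graph71₁ ha hb hc).integral u₁ ≠ (graph71₂ ha hb hc).integral u₂) := by
  refine ⟨isospectral71 ha hb hc, ⟨_, (isTorsionFunction71₁_iff ha hb hc).2 rfl,
    fun u hu => (isTorsionFunction71₁_iff ha hb hc).1 hu⟩,
    ⟨_, (isTorsionFunction71₂_iff ha hb hc).2 rfl,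
    fun u hu => (isTorsionFunction71₂_iff ha hb hc).1 hu⟩,
    torsionN_neg ha hb hc, torsionD_pos ha hb hc, fun u₁ u₂ h₁ h₂ => integral71_sub ha hb hc h₁ h₂,
    fun hab hac hbc => ⟨isEmpty_isometryEquiv71 ha hb hc hab hac hbc, fun u₁ u₂ h₁ h₂ => ?_⟩⟩
  rw [← sub_ne_zero, integral71_sub ha hb hc h₁ h₂]
  exact mul_ne_zero (mul_ne_zero (mul_ne_zero (sub_ne_zero.2 hab) (sub_ne_zero.2 hac))
    (sub_ne_zero.2 hbc)) (div_ne_zero (torsionN_neg ha hb hc).ne (torsionD_pos ha hb hc).ne')
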